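/- **Theorem 1.2.** Let $D\subseteq\mathbb R^d$ be a compact convex set with $0\in\operatorname{int}(D)$ and $D=-D$, and let $D^\circ=\{z: x\cdot z\le 1\ \ \forall x\in D\}$ be its polar set. Let $\alpha\in(0,1)$. Write $\hat f(\xi)=\int_{\mathbb R^d} f(x)e^{-2\pi i\,\xi\cdot x}\,dx$, let $|\cdot|$ be the Euclidean norm, and for $B=D^\circ$ or $B=B_1$ (the closed Euclidean unit ball) let $|x|_B=\inf\{a>0: x\in aB\}$. For $\Omega\subseteq\mathbb R^d$ put $$\delta_B(\Omega)=\sup_{z\in\mathbb R^d}\inf_{\omega\in\Omega}|\omega-z|_B\in[0,\infty],\qquad V_\omega=\{z:\ |\omega-z|_{D^\circ}\le|\lambda-z|_{D^\circ}\ \ \forall\lambda\in\Omega,\ \lambda\neq\omega\},\qquad \mu_\omega=\operatorname{meas}(V_\omega)\quad(\omega\in\Omega).$$ Let $L^2(D)$ be the space of complex-valued $f\in L^2(\mathbb R^d)$ that vanish a.e. outside $D$. For a linear subspace $R\subseteq L^2(D)$ and $K\in\mathbb R$ put $$V(R,\Omega,K)=\inf_{f\in R,\,\|f\|_2=1}\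 \sum_{\omega\in\Omega,\,|\omega|\le K}\mu_\omega|\hat f(\omega)|^2,\qquad V_*(R,\Omega,K)=\sup_{f\in R,\,\|f\|_2=1}\ \sum_{\omega\in\Omega,\,|\omega|>K}\mu_\omega|\hat f(\omega)|^2,$$ $$V(R,K)=\inf_{f\in R,\,\|f\|_2=1}\ \int_{|\xi|\le K}|\hat f(\xi)|^2\,d\xi,\qquad V_*(R,K)=\sup_{f\in R,\,\|f\|_2=1}\ \int_{|\xi|>K}|\hat f(\xi)|^2\,d\xi,$$ as elements of $[0,\infty]$ (with $\inf\emptyset=\infty$, $\sup\emptyset=0$). 1. For every $L>0$ there are constants $c,C>0$ depending only on $\alpha$, $L$ and $D$ such that, for every closed countable $\Omega\subseteq\mathbb R^d$ with $\delta_{B_1}(\Omega)\le L$ whose Voronoi regions are almost disjoint (that is, $\operatorname{meas}(V_\omega\cap V_{\omega'})=0$ for all distinct $\omega,\omega'\in\Omega$) and every linear subspace $R\subseteq L^2(D)$, $$V(R,\Omega,K)\le C\,V(R,K+M)+Ce^{-cM^\alpha}\quad(K,M>0),$$ $$V_*(R,\Omega,K)\le C\,V_*(R,K-M)+Ce^{-cM^\alpha}\quad(K>M>0).$$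 2. For every $\varepsilon>0$ there are constants $c,C>0$ depending only on $\varepsilon$, $\alpha$ and $D$ such that, for every closed countable $\Omega\subseteq\mathbb R^d$ with $\delta_{D^\circ}(\Omega)\le\frac14(1-\varepsilon)$ and every linear subspace $R\subseteq L^2(D)$, $$V(R,K)\le C\,V(R,\Omega,K+M)+Ce^{-cM^\alpha}\quad(K,M>0),$$ $$V_*(R,K)\le C\,V_*(R,\Omega,K-M)+Ce^{-cM^\alpha}\quad(K,M>0).$$ -/

import Mathlib

open MeasureTheory Set
open scoped FourierTransform ENNReal

noncomputable section

namespace FourierSampling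

/-- The Euclidean space `ℝ^d` (used both for the space and for the frequency domain). -/
abbrev E (d : ℕ) : Type := EuclideanSpace ℝ (Fin d)

/-- A centered symmetric convex body: compact, convex, `0` in the interior, `D = -D`. -/
structure IsCenteredSymmetricConvexBody {d : ℕ} (D : Set (E d)) : Prop where
  isCompact : IsCompact D
  convex : Convex ℝ D
  zero_mem_interior : (0 : E d) ∈ interior D
  symm : -D = D

/-- The polar set `D° = {z | ∀ x ∈ D, x · z ≤ 1}`. -/
def polarSet {d : ℕ} (D : Set (E d)) : Set (E d) :=
  {z | ∀ x ∈ D, inner ℝ x z ≤ 1}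

/-- The gap `δ_B(Ω) = sup_z inf_{ω ∈ Ω} |ω - z|_B` of `Ω` with respect to the norm
`|x|_B = inf {a > 0 | x ∈ a B} = gauge B x`. It takes values in `[0, ∞]`; it is `∞` for `Ω = ∅`. -/
def gap {d : ℕ} (B Ω : Set (E d)) : ℝ≥0∞ :=
  ⨆ z : E d, ⨅ ω ∈ Ω, ENNReal.ofReal (gauge B (ω - z))

/-- The Voronoi region of `ω` relative to `Ω`, with respect to the norm `|·|_B`. -/
def voronoiRegion {d : ℕ} (B Ω : Set (E d)) (ω : E d) : Set (E d) :=
  {z | ∀ v ∈ Ω, v ≠ ω → gauge B (ω - z) ≤ gauge B (v - z)}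

/-- The Voronoi weight `μ_ω`: the Lebesgue measure of the Voronoi region. -/
def voronoiWeight {d : ℕ} (B Ω : Set (E d)) (ω : E d) : ℝ≥0∞ :=
  volume (voronoiRegion B Ω ω)

/-- `L²(D)`, as the subspace of `L²(ℝ^d)` of the functions that vanish a.e. outside `D`. -/
def L2On {d : ℕ} (D : Set (E d)) : Submodule ℂ (Lp ℂ 2 (volume : Measure (E d))) where
  carrier := {f | ∀ᵐ x ∂(volume : Measure (E d)), x ∉ D → f x = 0}
  zero_mem' := by
    filter_upwards [Lp.coeFn_zero ℂ 2 (volume : Measure (E d))] with x hx _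
    exact hx
  add_mem' := by
    intro f g hf hg
    filter_upwards [hf, hg, Lp.coeFn_add f g] with x h1 h2 h3 hx
    have h4 : (f + g : Lp ℂ 2 (volume : Measure (E d))) x = f x + g x := h3
    exact h4.trans (by rw [h1 hx, h2 hx, add_zero])
  smul_mem' := by
    intro a f hf
    filter_upwards [hf, Lp.coeFn_smul a f] with x h1 h2 hx
    simp [h2, h1 hx]

/-- The unit sphere `{f ∈ R | ‖f‖₂ = 1}` of a subspace of `L²(ℝ^d)`. -/
def unitSphere {d : ℕ} (R : Submodule ℂ (Lp ℂ 2 (volume : Measure (E d)))) :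
    Set (Lp ℂ 2 (volume : Measure (E d))) :=
  {f | f ∈ R ∧ ‖f‖ = 1}

/-- The sampled energy `∑_{ω ∈ S} μ_ω |f̂(ω)|²` over a part `S` of the sampling set `Ω`, where
the Voronoi weights are those of the whole set `Ω`, and
`f̂(ξ) = 𝓕 f ξ = ∫ f(x) exp(-2πi ξ·x) dx`. -/
def sampleEnergy {d : ℕ} (B Ω S : Set (E d)) (f : Lp ℂ 2 (volume : Measure (E d))) : ℝ≥0∞ :=
  ∑' ω : S, voronoiWeight B Ω ω * ‖𝓕 (f : E d → ℂ) ω‖ₑ ^ 2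

/-- The discrete concentration `V(R, Ω, K)`, with the Voronoi weights of the norm `|·|_B`. -/
def discreteConcentration {d : ℕ} (B : Set (E d))
    (R : Submodule ℂ (Lp ℂ 2 (volume : Measure (E d)))) (Ω : Set (E d)) (K : ℝ) : ℝ≥0∞ :=
  ⨅ f ∈ unitSphere R, sampleEnergy B Ω (Ω ∩ Metric.closedBall 0 K) f

/-- The discrete residual `V_*(R, Ω, K)`, with the Voronoi weights of the norm `|·|_B`.
(For `K < 0` the ball is empty and the sum is over all of `Ω`.) -/
def discreteResidual {d : ℕ} (B : Set (E d))
    (R : Submodule ℂ (Lp ℂ 2 (volume : Measure (E d)))) (Ω : Set (E d)) (K : ℝ) : ℝ≥0∞ :=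
  ⨆ f ∈ unitSphere R, sampleEnergy B Ω (Ω \ Metric.closedBall 0 K) f

/-- The continuous concentration `V(R, K)`. -/
def continuousConcentration {d : ℕ} (R : Submodule ℂ (Lp ℂ 2 (volume : Measure (E d)))) (K : ℝ) : ℝ≥0∞ :=
  ⨅ f ∈ unitSphere R, ∫⁻ ξ in {ξ : E d | ‖ξ‖ ≤ K}, ‖𝓕 (f : E d → ℂ) ξ‖ₑ ^ 2

/-- The continuous residual `V_*(R, K)`. -/
def continuousResidual {d : ℕ} (R : Submodule ℂ (Lp ℂ 2 (volume : Measure (E d)))) (K : ℝ) : ℝ≥0∞ :=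
  ⨆ f ∈ unitSphere R, ∫⁻ ξ in {ξ : E d | K < ‖ξ‖}, ‖𝓕 (f : E d → ℂ) ξ‖ₑ ^ 2

end FourierSampling

end

open FourierSampling

/-! Everything rests on a sup bound for bandlimited functions. If `g` on the line has spectrum in
`[-τ, τ]` with `τ < π` and `|g|` is maximal at `0`, then `|g 1| ≥ cos τ * |g 0|`. This follows from
an interpolation formula that expresses `g 1 - (sin τ / τ) * g' 0` through the values `g (nπ/τ)`,
with coefficients of controlled sign (`cos_mul_norm_integral_le`). Let `F` have spectrum in `D` and
let `|F|` be maximal at `z`. If a sample `ω` satisfies `|ω - z|_{D°} ≤ (1 - ε)/4`, all phases `2π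
p·(ω - z)` are below `π/2` and the cosine is positive: this is the role of `1/4`. The samples whose
cells meet a small ball around `z` then control `sup |F|²` by the weighted sampled energy
(`exists_enorm_sq_le_tsum`); all points near `z` control it by `∫ |F|²`
(`exists_enorm_sq_le_lintegral`).

To localize, the sup bound is applied to `f̂ * h(· - ξ)` and evaluated at `ξ`. Here `h` has spectrum
in a small ball, `h 0 = 1`, polynomial decay, and size `exp (-c M)` beyond distance `M`
(`exists_bandlimited_localizer`). Integrating over frequencies, or summing over samples with cell
volumes as weights, leaves the energy within distance `M` plus an exponentially small multiple of
the total. The total is controlled by Plancherel, or by the first comparison. The resulting error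
`exp (-c M)` is stronger than the required `exp (-c M^α)`. -/

namespace FourierSampling

/-! ### A Fourier series with coefficients of controlled sign -/

/-- The Fourier coefficients, on `[-1, 1]`, of `v ↦ exp (i τ v) - i v sin τ`. -/
noncomputable def interpCoeff (τ : ℝ) (n : ℤ) : ℝ :=
  if n = 0 then Real.sin τ / τ
  else (-1) ^ n * (τ * Real.sin τ) / (n * Real.pi * (τ - n * Real.pi))

lemma sub_int_mul_pi_ne_zero {τ : ℝ} (h0 : 0 < τ) (hπ : τ < Real.pi) (n : ℤ) :
    τ - n * Real.pi ≠ 0 := by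
  intro h
  have hp := Real.pi_pos
  have h1 : τ = n * Real.pi := by linarith
  have h2 : (0 : ℝ) < n := by
    by_contra hn
    push Not at hn
    nlinarith
  have h3 : (1 : ℝ) ≤ n := by exact_mod_cast (by exact_mod_cast h2 : 0 < n)
  nlinarith

lemma int_mul_pi_mul_sub_neg {τ : ℝ} (h0 : 0 < τ) (hπ : τ < Real.pi) {n : ℤ} (hn : n ≠ 0) :
    n * Real.pi * (τ - n * Real.pi) < 0 := by
  have hp := Real.pi_pos
  rcases lt_or_gt_of_ne hn with h | h
  · have h3 : (n : ℝ) ≤ -1 := by exact_mod_cast Int.le_sub_one_of_lt h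
    have : (n : ℝ) * Real.pi < 0 := by nlinarith
    nlinarith
  · have h3 : (1 : ℝ) ≤ n := by exact_mod_cast h
    have : (n : ℝ) * Real.pi ≥ Real.pi := by nlinarith
    nlinarith

/-- For `0 < τ < π` and `n ≠ 0` the factors `nπ` and `τ - nπ` have opposite signs. This sign pattern
makes the later lower bound hold term by term. -/
lemma neg_one_zpow_mul_interpCoeff_nonpos {τ : ℝ} (h0 : 0 < τ) (hπ : τ < Real.pi) {n : ℤ}
    (hn : n ≠ 0) : (-1) ^ n * interpCoeff τ n ≤ 0 := by
  rw [interpCoeff, if_neg hn, ← mul_div_assoc, ← mul_assoc, ← zpow_add₀ (by norm_num),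
    Even.neg_one_zpow ⟨n, rfl⟩, one_mul]
  exact div_nonpos_of_nonneg_of_nonpos
    (mul_nonneg h0.le (Real.sin_pos_of_pos_of_lt_pi h0 hπ).le)
    (int_mul_pi_mul_sub_neg h0 hπ hn).le

/-- Quadratic decay: `|τ - nπ| ≥ |n|π - τ ≥ |n|(π - τ)` as soon as `|n| ≥ 1`. -/
lemma summable_interpCoeff {τ : ℝ} (h0 : 0 < τ) (hπ : τ < Real.pi) :
    Summable (interpCoeff τ) := by
  have hp := Real.pi_pos
  have hs : Summable fun n : ℤ => (τ / (Real.pi * (Real.pi - τ))) * (1 / (n : ℝ) ^ 2) :=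
    (Real.summable_one_div_int_pow.2 one_lt_two).mul_left _
  refine Summable.of_norm_bounded_eventually hs ?_
  rw [Filter.eventually_cofinite]
  refine (Set.finite_singleton (0 : ℤ)).subset fun n hn => ?_
  by_contra h
  refine hn ?_
  have hn0 : n ≠ 0 := h
  rw [interpCoeff, if_neg hn0, Real.norm_eq_abs, abs_div, abs_mul, abs_zpow, abs_neg, abs_one,
    one_zpow, one_mul, div_mul_div_comm, mul_one, ← sq_abs]
  have hn1 : (1 : ℝ) ≤ |(n : ℝ)| := by exact_mod_cast Int.one_le_abs hn0
  have h1 : |τ * Real.sin τ| ≤ τ := by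
    rw [abs_mul, abs_of_pos h0]
    exact mul_le_of_le_one_right h0.le (Real.abs_sin_le_one _)
  have h2 : Real.pi * (Real.pi - τ) * |(n : ℝ)| ^ 2 ≤
      |n * Real.pi * (τ - n * Real.pi)| := by
    rw [abs_mul, abs_mul, abs_of_pos hp]
    have h3 : |(n : ℝ)| * (Real.pi - τ) ≤ |τ - n * Real.pi| := by
      have : |(n : ℝ) * Real.pi| - |τ| ≤ |τ - n * Real.pi| := by
        rw [abs_sub_comm]; exact abs_sub_abs_le_abs_sub _ _
      rw [abs_mul, abs_of_pos hp, abs_of_pos h0] at this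
      nlinarith
    calc _ = |(n : ℝ)| * Real.pi * (|(n : ℝ)| * (Real.pi - τ)) := by
          ring
      _ ≤ _ := by gcongr
  have h4 : 0 < Real.pi * (Real.pi - τ) * |(n : ℝ)| ^ 2 := by
    have : 0 < Real.pi - τ := by linarith
    positivity
  gcongr

lemma integral_interpCoeff {τ : ℝ} (h0 : 0 < τ) (hπ : τ < Real.pi) (n : ℤ) :
    ∫ x in (-1 : ℝ)..1, Complex.exp (-(Complex.I * (n * Real.pi) * x)) *
      (Complex.exp (Complex.I * τ * x) - Complex.I * x * Real.sin τ) = 2 * interpCoeff τ n := by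
  have hI := Complex.I_ne_zero
  have hcont : Continuous fun x : ℝ => Complex.exp (-(Complex.I * (n * Real.pi) * x)) *
      (Complex.exp (Complex.I * τ * x) - Complex.I * x * Real.sin τ) := by fun_prop
  have hsin : (Real.sin τ : ℂ) = (Complex.exp (-(τ * Complex.I)) - Complex.exp (τ * Complex.I))
      * Complex.I / 2 := by rw [Complex.ofReal_sin, Complex.sin, neg_mul]
  have hsub : (τ - n * Real.pi : ℂ) ≠ 0 := by
    exact_mod_cast sub_int_mul_pi_ne_zero h0 hπ n
  by_cases hn : n = 0
  · subst hn
    have hτ : (τ : ℂ) ≠ 0 := by exact_mod_cast h0.ne'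
    have hd : ∀ x ∈ uIcc (-1 : ℝ) 1, HasDerivAt (fun x : ℝ =>
        Complex.exp (Complex.I * τ * x) / (Complex.I * τ) - Complex.I * x ^ 2 / 2 * Real.sin τ)
        (Complex.exp (-(Complex.I * ((0 : ℤ) * Real.pi) * x)) *
          (Complex.exp (Complex.I * τ * x) - Complex.I * x * Real.sin τ)) x := by
      intro x _
      have hx := (hasDerivAt_id x).ofReal_comp
      have h1 := ((hx.const_mul (Complex.I * τ)).cexp).div_const (Complex.I * τ)
      have h2 := (((hx.pow 2).const_mul Complex.I).div_const 2).mul_const (Real.sin τ : ℂ)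
      convert! h1.sub h2 using 1
      simp
      field_simp
    rw [intervalIntegral.integral_eq_sub_of_hasDerivAt hd (hcont.intervalIntegrable _ _),
      interpCoeff, if_pos rfl, Complex.ofReal_div, hsin]
    push_cast
    field_simp
    ring_nf
    simp [Complex.I_sq]
    ring_nf
  · have hpn : (n * Real.pi : ℂ) ≠ 0 := by
      exact_mod_cast mul_ne_zero (Int.cast_ne_zero.2 hn) Real.pi_ne_zero
    set w : ℂ := n * Real.pi with hw
    have hd : ∀ x ∈ uIcc (-1 : ℝ) 1, HasDerivAt (fun x : ℝ =>
        Complex.exp (Complex.I * (τ - w) * x) / (Complex.I * (τ - w)) -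
          Complex.I * Real.sin τ * (x * Complex.exp (-(Complex.I * w) * x) / (-(Complex.I * w)) -
            Complex.exp (-(Complex.I * w) * x) / (-(Complex.I * w)) ^ 2))
        (Complex.exp (-(Complex.I * w * x)) *
          (Complex.exp (Complex.I * τ * x) - Complex.I * x * Real.sin τ)) x := by
      intro x _
      have hx := (hasDerivAt_id x).ofReal_comp
      have h1 := ((hx.const_mul (Complex.I * (τ - w))).cexp).div_const (Complex.I * (τ - w))
      have h2 := (hx.const_mul (-(Complex.I * w))).cexp
      have h3 := ((hx.mul h2).div_const (-(Complex.I * w))).sub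
        (h2.div_const ((-(Complex.I * w)) ^ 2))
      convert! h1.sub (h3.const_mul (Complex.I * Real.sin τ)) using 1
      have e1 : Complex.exp (Complex.I * (τ - w) * x) =
          Complex.exp (-(Complex.I * w * x)) * Complex.exp (Complex.I * τ * x) := by
        rw [← Complex.exp_add]; ring_nf
      have e2 : -(Complex.I * w) * (x : ℂ) = -(Complex.I * w * x) := by ring
      simp only [id_eq, Complex.ofReal_one, e2, e1]
      field_simp
      ring
    rw [intervalIntegral.integral_eq_sub_of_hasDerivAt hd (hcont.intervalIntegrable _ _),
      interpCoeff, if_neg hn]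
    have hz : ∀ m : ℤ, Complex.exp (Complex.I * (m * Real.pi)) = (-1) ^ m := by
      intro m
      rw [show Complex.I * (m * Real.pi) = m * (Real.pi * Complex.I) by ring, Complex.exp_int_mul,
        Complex.exp_pi_mul_I]
    have hz1 : Complex.exp (Complex.I * w) = (-1) ^ n := hz n
    have hz2 : Complex.exp (-(Complex.I * w)) = (-1) ^ n := by
      have := hz (-n)
      rw [Int.cast_neg, zpow_neg, ← inv_zpow, inv_neg, inv_one] at this
      rw [← this, hw]; ring_nf
    have e1 : Complex.exp (Complex.I * (τ - w) * ((1 : ℝ) : ℂ)) =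
        (-1) ^ n * Complex.exp (τ * Complex.I) := by
      rw [← hz2, ← Complex.exp_add]; push_cast; ring_nf
    have e2 : Complex.exp (Complex.I * (τ - w) * ((-1 : ℝ) : ℂ)) =
        (-1) ^ n * Complex.exp (-(τ * Complex.I)) := by
      rw [← hz1, ← Complex.exp_add]; push_cast; ring_nf
    have e3 : Complex.exp (-(Complex.I * w) * ((1 : ℝ) : ℂ)) = (-1) ^ n := by
      rw [← hz2]; push_cast; ring_nf
    have e4 : Complex.exp (-(Complex.I * w) * ((-1 : ℝ) : ℂ)) = (-1) ^ n := by
      rw [← hz1]; push_cast; ring_nf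
    rw [e1, e2, e3, e4]
    have e5 : (((-1 : ℝ) ^ n * (τ * Real.sin τ) / (n * Real.pi * (τ - n * Real.pi)) : ℝ) : ℂ) =
      (-1) ^ n * (τ * Real.sin τ) / (w * (τ - w)) := by push_cast; rfl
    rw [e5]
    have e6 : Complex.exp (τ * Complex.I) - Complex.exp (-(τ * Complex.I)) =
        2 * Complex.I * Real.sin τ := by
      rw [hsin]; ring_nf; simp [Complex.I_sq]; ring
    have e7 : Complex.exp (τ * Complex.I) = Complex.exp (-(τ * Complex.I)) +
        2 * Complex.I * Real.sin τ := by rw [← e6]; ring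
    rw [e7]
    push_cast
    field_simp
    ring

/-- The Fourier series of `v ↦ exp (i τ v) - i v sin τ` on `[-1, 1]`. -/
theorem hasSum_interpCoeff_mul_exp {τ : ℝ} (h0 : 0 < τ) (hπ : τ < Real.pi) {v : ℝ}
    (hv : |v| ≤ 1) :
    HasSum (fun n : ℤ => (interpCoeff τ n : ℂ) * Complex.exp (Complex.I * (n * Real.pi) * v))
      (Complex.exp (Complex.I * τ * v) - Complex.I * v * Real.sin τ) := by
  have : Fact ((0 : ℝ) < 2) := ⟨by norm_num⟩
  set f : ℝ → ℂ := fun v => Complex.exp (Complex.I * τ * v) - Complex.I * v * Real.sin τ with hf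
  have hfc : Continuous f := by fun_prop
  have hsin : (Real.sin τ : ℂ) = (Complex.exp (-(τ * Complex.I)) - Complex.exp (τ * Complex.I))
      * Complex.I / 2 := by rw [Complex.ofReal_sin, Complex.sin, neg_mul]
  -- Subtracting `i v sin τ` makes both endpoint values equal to `cos τ`, so the 2-periodic
  -- extension is continuous.
  have hend : f (-1) = f (-1 + 2) := by
    simp only [hf]
    rw [hsin]
    norm_num
    ring_nf
    simp [Complex.I_sq]
    ring_nf
  have hcont : Continuous (AddCircle.liftIco (2 : ℝ) (-1) f) :=
    AddCircle.liftIco_continuous hend hfc.continuousOn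
  set g : C(AddCircle (2 : ℝ), ℂ) := ⟨_, hcont⟩
  have hcoeff : ∀ n : ℤ, fourierCoeff g n = interpCoeff τ n := by
    intro n
    change fourierCoeff (AddCircle.liftIco (2 : ℝ) (-1) f) n = _
    rw [fourierCoeff_liftIco_eq, fourierCoeffOn_eq_integral]
    have h2 : (∫ x in (-1 : ℝ)..(-1 + 2), fourier (-n) (x : AddCircle (-1 + 2 - -1 : ℝ)) • f x) =
        2 * interpCoeff τ n := by
      rw [← integral_interpCoeff h0 hπ n, show (-1 + 2 : ℝ) = 1 by norm_num]
      congr 1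
      ext x
      rw [fourier_coe_apply, smul_eq_mul]
      congr 2
      push_cast
      ring
    rw [h2, Complex.real_smul]
    push_cast
    ring
  have hsum : Summable (fourierCoeff g) := by
    rw [funext hcoeff]
    exact Complex.summable_ofReal.2 (summable_interpCoeff h0 hπ)
  have hg : ∀ v : ℝ, v ∈ Ico (-1 : ℝ) 1 → HasSum (fun n : ℤ =>
      (interpCoeff τ n : ℂ) * Complex.exp (Complex.I * (n * Real.pi) * v)) (f v) := by
    intro v hv
    have h := has_pointwise_sum_fourier_series_of_summable hsum (v : AddCircle (2 : ℝ))
    have h1 : AddCircle.liftIco (2 : ℝ) (-1) f v = f v :=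
      AddCircle.liftIco_coe_apply (by rwa [show (-1 + 2 : ℝ) = 1 by norm_num])
    change HasSum _ (AddCircle.liftIco (2 : ℝ) (-1) f v) at h
    rw [h1] at h
    convert! h using 2 with n
    rw [hcoeff, fourier_coe_apply, smul_eq_mul]
    congr 2
    push_cast
    ring
  rcases (abs_le.1 hv).2.lt_or_eq with h | h
  · exact hg v ⟨(abs_le.1 hv).1, h⟩
  -- The half-open period omits `v = 1`; both sides agree there with their values at `-1`.
  · subst h
    have h := hg (-1) (by norm_num)
    rw [hend, show (-1 + 2 : ℝ) = 1 by norm_num] at h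
    convert! h using 2 with n
    congr 1
    rw [← Complex.exp_periodic.int_mul n (_ * ((-1 : ℝ) : ℂ))]
    congr 1
    push_cast
    ring

/-- The series at `v = 1`, where the linear correction removes exactly the imaginary part of `exp (i
τ)`. This sum is the source of the constant `cos τ`. -/
lemma hasSum_interpCoeff_mul_neg_one_zpow {τ : ℝ} (h0 : 0 < τ) (hπ : τ < Real.pi) :
    HasSum (fun n : ℤ => interpCoeff τ n * (-1) ^ n) (Real.cos τ) := by
  have h := hasSum_interpCoeff_mul_exp h0 hπ (v := 1) (by simp)
  rw [← Complex.hasSum_ofReal]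
  convert! h using 1
  · ext n
    rw [Complex.ofReal_one, mul_one, show Complex.I * (n * Real.pi) = n * (Real.pi * Complex.I)
      by ring, Complex.exp_int_mul, Complex.exp_pi_mul_I]
    push_cast; rfl
  · rw [Complex.ofReal_one, mul_one, mul_one, mul_comm Complex.I, Complex.exp_mul_I]
    push_cast; ring

/-! ### One-variable exponential integrals near a maximum of the modulus -/

section ExponentialIntegral

variable {X : Type*} [MeasurableSpace X] {μ : Measure X} {a : X → ℂ} {s : X → ℝ} {τ : ℝ}

lemma norm_mul_exp_I_mul (z : ℂ) (t : ℝ) : ‖z * Complex.exp (Complex.I * t)‖ = ‖z‖ := by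
  rw [norm_mul, mul_comm Complex.I, Complex.norm_exp_ofReal_mul_I, mul_one]

lemma integrable_mul_exp (ha : Integrable a μ) (hs : Measurable s) :
    Integrable (fun x => a x * Complex.exp (Complex.I * s x)) μ := by
  refine ha.norm.mono' (ha.1.mul (by fun_prop)) (.of_forall fun x => ?_)
  rw [norm_mul_exp_I_mul]

lemma hasDerivAt_integral_mul_exp (ha : Integrable a μ) (hs : Measurable s)
    (hsτ : ∀ x, |s x| ≤ τ) :
    HasDerivAt (fun t : ℝ => ∫ x, a x * Complex.exp (Complex.I * (t * s x : ℝ)) ∂μ)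
      (∫ x, a x * (Complex.I * s x) ∂μ) 0 := by
  have h := hasDerivAt_integral_of_dominated_loc_of_deriv_le (μ := μ) (x₀ := (0 : ℝ))
    (F := fun t x => a x * Complex.exp (Complex.I * (t * s x : ℝ)))
    (F' := fun t x => a x * (Complex.exp (Complex.I * (t * s x : ℝ)) * (Complex.I * s x)))
    (bound := fun x => ‖a x‖ * τ) Filter.univ_mem
    (.of_forall fun t => (integrable_mul_exp ha (hs.const_mul t)).1)
    (integrable_mul_exp ha (hs.const_mul 0))
    (ha.1.mul (by fun_prop)) (.of_forall fun x t _ => ?_) (ha.norm.mul_const _)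
    (.of_forall fun x t _ => ?_)
  · simpa using h.2
  · rw [← mul_assoc, norm_mul, norm_mul_exp_I_mul, norm_mul, Complex.norm_I, one_mul,
      Complex.norm_real]
    exact mul_le_mul_of_nonneg_left (hsτ x) (norm_nonneg _)
  · have h1 : HasDerivAt (fun t : ℝ => Complex.I * (t * s x : ℝ)) (Complex.I * s x) t := by
      have := (((hasDerivAt_id t).mul_const (s x)).ofReal_comp).const_mul Complex.I
      simpa using this
    exact h1.cexp.const_mul _

/-- The interpolation formula for a function with spectrum in `[-τ, τ]`. -/
lemma hasSum_interpCoeff_mul_integral (h0 : 0 < τ) (hπ : τ < Real.pi) (ha : Integrable a μ)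
    (hs : Measurable s) (hsτ : ∀ x, |s x| ≤ τ) :
    HasSum (fun n : ℤ => (interpCoeff τ n : ℂ) *
        ∫ x, a x * Complex.exp (Complex.I * (n * Real.pi / τ * s x : ℝ)) ∂μ)
      (∫ x, a x * Complex.exp (Complex.I * s x) ∂μ -
        Real.sin τ / τ * ∫ x, a x * (Complex.I * s x) ∂μ) := by
  have hτ : (τ : ℂ) ≠ 0 := by exact_mod_cast h0.ne'
  have hint := fun n : ℤ => (integrable_mul_exp ha (hs.const_mul (n * Real.pi / τ))).const_mul
    (interpCoeff τ n : ℂ)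
  have h := hasSum_integral_of_summable_integral_norm hint (by
    simp_rw [norm_mul (interpCoeff τ _ : ℂ), norm_mul_exp_I_mul, integral_const_mul,
      Complex.norm_real]
    exact (summable_interpCoeff h0 hπ).norm.mul_right _)
  simp_rw [integral_const_mul] at h
  convert! h using 1
  rw [← integral_const_mul, ← integral_sub (integrable_mul_exp ha hs)]
  · refine integral_congr_ae (.of_forall fun x => ?_)
    -- The series is used at `v = s x / τ`; this rescaling places the interpolation nodes at `nπ/τ`.
    have hv : |s x / τ| ≤ 1 := by
      rw [abs_div, abs_of_pos h0]
      exact div_le_one_of_le₀ (hsτ x) h0.le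
    have := (hasSum_interpCoeff_mul_exp h0 hπ hv).mul_left (a x)
    have h2 : HasSum (fun n : ℤ => (interpCoeff τ n : ℂ) * (a x * Complex.exp
        (Complex.I * (n * Real.pi / τ * s x : ℝ)))) (a x * Complex.exp (Complex.I * s x) -
        Real.sin τ / τ * (a x * (Complex.I * s x))) := by
      convert! this using 1
      · ext n
        rw [mul_left_comm]
        congr 3
        push_cast
        ring
      · push_cast
        rw [mul_assoc Complex.I, mul_div_cancel₀ _ hτ]
        field_simp
    exact h2.tsum_eq.symm
  · refine Integrable.const_mul ?_ _
    refine (ha.norm.mul_const τ).mono' (ha.1.mul (by fun_prop)) (.of_forall fun x => ?_)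
    rw [norm_mul, norm_mul, Complex.norm_I, one_mul, Complex.norm_real]
    exact mul_le_mul_of_nonneg_left (hsτ x) (norm_nonneg _)

/-- If a function with spectrum in `[-τ, τ]`, `τ < π`, attains its maximum modulus at `0`, then
its modulus at `1` is at least `cos τ` times the maximum. -/
theorem cos_mul_norm_integral_le (h0 : 0 < τ) (hπ : τ < Real.pi) (ha : Integrable a μ)
    (hs : Measurable s) (hsτ : ∀ x, |s x| ≤ τ)
    (hmax : ∀ t : ℝ, ‖∫ x, a x * Complex.exp (Complex.I * (t * s x : ℝ)) ∂μ‖ ≤ ‖∫ x, a x ∂μ‖) :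
    Real.cos τ * ‖∫ x, a x ∂μ‖ ≤ ‖∫ x, a x * Complex.exp (Complex.I * s x) ∂μ‖ := by
  set m := ‖∫ x, a x ∂μ‖ with hm
  set G : ℝ → ℂ := fun t => ∫ x, a x * Complex.exp (Complex.I * (t * s x : ℝ)) ∂μ with hG
  -- A rotation makes the value at `0` real and equal to the maximum `m`; the real part is then
  -- maximal at `0`, which kills the derivative term.
  obtain ⟨θ, hθ1, hθ⟩ : ∃ θ : ℂ, ‖θ‖ = 1 ∧ θ * G 0 = m := by
    obtain ⟨θ, h1, h2⟩ := RCLike.exists_norm_eq_mul_self (∫ x, a x ∂μ)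
    exact ⟨θ, h1, by simp only [hG, hm]; rw [show ((‖∫ x, a x ∂μ‖ : ℝ) : ℂ) = _ from h2]; simp⟩
  have hre : ∀ t, |(θ * G t).re| ≤ m := fun t =>
    (Complex.abs_re_le_norm _).trans (by rw [norm_mul, hθ1, one_mul]; exact hmax t)
  have hderiv : (θ * ∫ x, a x * (Complex.I * s x) ∂μ).re = 0 := by
    have h := Complex.reCLM.hasFDerivAt.comp_hasDerivAt 0
      ((hasDerivAt_integral_mul_exp ha hs hsτ).const_mul θ)
    refine IsLocalMax.hasDerivAt_eq_zero (.of_forall fun t => ?_) h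
    change (θ * G t).re ≤ (θ * G 0).re
    rw [hθ, Complex.ofReal_re]
    exact (abs_le.1 (hre t)).2
  have hsum := (hasSum_interpCoeff_mul_integral h0 hπ ha hs hsτ).mul_left θ
  have hsum' := Complex.hasSum_re hsum
  have hlow := (hasSum_interpCoeff_mul_neg_one_zpow h0 hπ).mul_right m
  -- Termwise comparison: equality at `n = 0`, and for other `n` the worst case allowed by `|Re (θ
  -- G)| ≤ m`, which the sign pattern turns into `(-1)^n * interpCoeff τ n * m`.
  have hle := hasSum_le (fun n => ?_) hlow hsum'
  · have e : (θ * (∫ x, a x * Complex.exp (Complex.I * s x) ∂μ -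
        Real.sin τ / τ * ∫ x, a x * (Complex.I * s x) ∂μ)).re =
        (θ * ∫ x, a x * Complex.exp (Complex.I * s x) ∂μ).re := by
      rw [mul_sub, Complex.sub_re, mul_left_comm, ← Complex.ofReal_div, Complex.re_ofReal_mul,
        hderiv, mul_zero, sub_zero]
    rw [e] at hle
    refine hle.trans ((Complex.re_le_norm _).trans ?_)
    rw [norm_mul, hθ1, one_mul]
  · change _ ≤ (θ * (interpCoeff τ n * G (n * Real.pi / τ))).re
    rw [mul_left_comm, Complex.re_ofReal_mul]
    rcases eq_or_ne n 0 with rfl | hn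
    · rw [Int.cast_zero, zero_mul, zero_div, hθ]; simp
    · have h1 := neg_one_zpow_mul_interpCoeff_nonpos h0 hπ hn
      have h2 := abs_le.1 (hre (n * Real.pi / τ))
      rcases Int.even_or_odd n with he | ho
      · rw [he.neg_one_zpow] at h1 ⊢
        nlinarith
      · rw [ho.neg_one_zpow] at h1 ⊢
        nlinarith

end ExponentialIntegral

/-! ### Bandlimited functions of several variables -/

/-- `F` is the Fourier transform `ξ ↦ ∫ a(x) exp(-2πi p(x)·ξ) dμ(x)` of a finite complex measure
carried by `S`. -/
def IsBandlimited {d : ℕ} (S : Set (E d)) (F : E d → ℂ) : Prop :=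
  ∃ (X : Type) (_ : MeasurableSpace X) (μ : Measure X) (_ : SFinite μ) (a : X → ℂ) (p : X → E d),
    Integrable a μ ∧ Measurable p ∧ (∀ x, p x ∈ S) ∧
      ∀ ξ, F ξ = ∫ x, a x * Complex.exp (Complex.I * (-(2 * Real.pi) * inner ℝ (p x) ξ : ℝ)) ∂μ

namespace IsBandlimited

variable {d : ℕ} {S T : Set (E d)} {F G : E d → ℂ}

lemma mono (hF : IsBandlimited S F) (h : S ⊆ T) : IsBandlimited T F := by
  obtain ⟨X, _, μ, _, a, p, ha, hp, hS, hF⟩ := hF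
  exact ⟨X, _, μ, ‹_›, a, p, ha, hp, fun x => h (hS x), hF⟩

-- The product measure with position map `p + q` plays the role of the convolution of the two
-- spectral measures; s-finiteness is what Fubini needs.
open scoped Pointwise in
lemma mul (hF : IsBandlimited S F) (hG : IsBandlimited T G) :
    IsBandlimited (S + T) (fun ξ => F ξ * G ξ) := by
  obtain ⟨X, _, μ, _, a, p, ha, hp, hS, hF⟩ := hF
  obtain ⟨Y, _, ν, _, b, q, hb, hq, hT, hG⟩ := hG
  refine ⟨X × Y, _, μ.prod ν, inferInstance, fun z => a z.1 * b z.2, fun z => p z.1 + q z.2,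
    ha.mul_prod hb, (hp.comp measurable_fst).add (hq.comp measurable_snd),
    fun z => add_mem_add (hS _) (hT _), fun ξ => ?_⟩
  simp only [hF, hG, ← integral_prod_mul]
  congr 1
  ext z
  rw [mul_mul_mul_comm, ← Complex.exp_add, inner_add_left]
  congr 2
  push_cast
  ring

lemma one : IsBandlimited (d := d) {0} (fun _ => 1) :=
  ⟨Unit, _, Measure.dirac (), inferInstance, fun _ => 1, fun _ => 0, integrable_const _,
    measurable_const, fun _ => rfl, fun ξ => by simp⟩

lemma comp_sub_const (hF : IsBandlimited S F) (η : E d) :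
    IsBandlimited S (fun ξ => F (ξ - η)) := by
  obtain ⟨X, _, μ, _, a, p, ha, hp, hS, hF⟩ := hF
  refine ⟨X, _, μ, ‹_›,
    fun x => a x * Complex.exp (Complex.I * (2 * Real.pi * inner ℝ (p x) η : ℝ)), p,
    integrable_mul_exp ha (by fun_prop), hp, hS, fun ξ => ?_⟩
  simp only [hF]
  congr 1
  ext x
  rw [mul_assoc, ← Complex.exp_add, inner_sub_right]
  congr 2
  push_cast
  ring

lemma exists_norm_le (hF : IsBandlimited S F) : ∃ B, ∀ ξ, ‖F ξ‖ ≤ B := by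
  obtain ⟨X, _, μ, _, a, p, ha, hp, hS, hF⟩ := hF
  refine ⟨∫ x, ‖a x‖ ∂μ, fun ξ => ?_⟩
  rw [hF]
  refine (norm_integral_le_integral_norm _).trans_eq ?_
  simp_rw [norm_mul_exp_I_mul]

lemma continuous (hF : IsBandlimited S F) : Continuous F := by
  obtain ⟨X, _, μ, _, a, p, ha, hp, hS, hF⟩ := hF
  rw [funext hF]
  refine continuous_of_dominated (bound := fun x => ‖a x‖)
    (fun ξ => (integrable_mul_exp ha (by fun_prop)).1)
    (fun ξ => .of_forall fun x => (norm_mul_exp_I_mul _ _).le) ha.norm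
    (.of_forall fun x => by fun_prop)

/-- Near a point where a bandlimited function attains its maximum modulus, the function is
comparable to its maximum. -/
theorem cos_mul_norm_le (hF : IsBandlimited S F) {z v : E d} (hz : ∀ ξ, ‖F ξ‖ ≤ ‖F z‖)
    {τ : ℝ} (h0 : 0 < τ) (hπ : τ < Real.pi)
    (hv : ∀ p ∈ S, |2 * Real.pi * inner ℝ p v| ≤ τ) :
    Real.cos τ * ‖F z‖ ≤ ‖F (z + v)‖ := by
  obtain ⟨X, _, μ, _, a, p, ha, hp, hS, hF⟩ := hF
  -- On the line through `z` in direction `v`, the function is a one-variable exponential integral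
  -- with frequencies `-2π p·v`.
  have key : ∀ t : ℝ, F (z + t • v) = ∫ x, a x *
      Complex.exp (Complex.I * (-(2 * Real.pi) * inner ℝ (p x) z : ℝ)) *
      Complex.exp (Complex.I * (t * (-(2 * Real.pi) * inner ℝ (p x) v) : ℝ)) ∂μ := by
    intro t
    rw [hF]
    congr 1
    ext x
    rw [mul_assoc, ← Complex.exp_add, inner_add_right, inner_smul_right]
    congr 2
    push_cast
    ring
  have e0 := key 0
  have e1 := key 1
  simp only [zero_smul, add_zero, zero_mul, Complex.ofReal_zero, mul_zero, Complex.exp_zero,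
    mul_one, one_smul, one_mul] at e0 e1
  rw [e0, e1]
  refine cos_mul_norm_integral_le h0 hπ (integrable_mul_exp ha (by fun_prop)) (by fun_prop)
    (fun x => ?_) (fun t => ?_)
  · rw [neg_mul, abs_neg]
    exact hv _ (hS x)
  · rw [← e0, ← key]
    exact hz _

lemma mul_closedBall {r s : ℝ} (hF : IsBandlimited (Metric.closedBall 0 r) F)
    (hG : IsBandlimited (Metric.closedBall 0 s) G) :
    IsBandlimited (Metric.closedBall 0 (r + s)) (fun ξ => F ξ * G ξ) := by
  refine (hF.mul hG).mono ?_
  rintro _ ⟨x, hx, y, hy, rfl⟩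
  rw [mem_closedBall_zero_iff] at *
  exact (norm_add_le _ _).trans (add_le_add hx hy)

lemma prod_closedBall {ι : Type*} (s : Finset ι) {f : ι → E d → ℂ} {r : ℝ}
    (hf : ∀ i ∈ s, IsBandlimited (Metric.closedBall 0 r) (f i)) :
    IsBandlimited (Metric.closedBall 0 (s.card * r)) (fun ξ => ∏ i ∈ s, f i ξ) := by
  classical
  induction s using Finset.induction_on with
  | empty => simpa using one
  | insert i s hi ih =>
    have h := (hf i (Finset.mem_insert_self i s)).mul_closedBall
      (ih fun j hj => hf j (Finset.mem_insert_of_mem hj))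
    simp only [Finset.prod_insert hi, Finset.card_insert_of_notMem hi]
    convert! h using 2
    push_cast
    ring

lemma pow_closedBall {r : ℝ} (hF : IsBandlimited (Metric.closedBall 0 r) F) (n : ℕ) :
    IsBandlimited (Metric.closedBall 0 (n * r)) (fun ξ => F ξ ^ n) := by
  simpa using prod_closedBall (Finset.range n) (f := fun _ => F) fun _ _ => hF

/-- `sinc` is the transform of the uniform probability measure on a segment of half-length `b` along
the `i`-th axis. Clamping by `projIcc` keeps the position map in the ball at every point, not just
on the integration interval. -/
lemma sinc {b : ℝ} (hb : 0 ≤ b) (i : Fin d) :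
    IsBandlimited (Metric.closedBall 0 b) (fun ξ : E d => (Real.sinc (2 * Real.pi * b * ξ i) : ℂ)) := by
  have h11 : (-1 : ℝ) ≤ 1 := by norm_num
  refine ⟨ℝ, _, volume.restrict (Ioc (-1) 1), inferInstance, fun _ => 1 / 2,
    fun x => (-b * (projIcc (-1 : ℝ) 1 h11 x : ℝ)) • EuclideanSpace.single i (1 : ℝ),
    integrable_const _, ?_, fun x => ?_, fun ξ => ?_⟩
  · have : Continuous (projIcc (-1 : ℝ) 1 h11) := continuous_projIcc
    fun_prop
  · rw [mem_closedBall_zero_iff, norm_smul, norm_mul, norm_neg, Real.norm_of_nonneg hb]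
    have : ‖(projIcc (-1 : ℝ) 1 h11 x : ℝ)‖ ≤ 1 := abs_le.2 (projIcc (-1 : ℝ) 1 h11 x).2
    simpa using mul_le_of_le_one_right hb this
  · set y := 2 * Real.pi * b * ξ i with hy
    have h1 : ∫ x in Ioc (-1 : ℝ) 1, (1 / 2 : ℂ) * Complex.exp (Complex.I * (-(2 * Real.pi) *
        inner ℝ ((-b * (projIcc (-1 : ℝ) 1 h11 x : ℝ)) • EuclideanSpace.single i (1 : ℝ)) ξ : ℝ)) =
        ∫ x in Ioc (-1 : ℝ) 1, (1 / 2 : ℂ) * Complex.exp (Complex.I * y * x) := by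
      refine setIntegral_congr_fun measurableSet_Ioc fun x hx => ?_
      simp only [projIcc_of_mem h11 (Ioc_subset_Icc_self hx), inner_smul_left,
        EuclideanSpace.inner_single_left, hy]
      congr 2
      simp
      ring
    change ((Real.sinc y : ℝ) : ℂ) = _
    rw [h1, ← intervalIntegral.integral_of_le h11]
    rcases eq_or_ne y 0 with h | h
    · rw [h]; norm_num
    · have hc : Complex.I * y ≠ 0 := mul_ne_zero Complex.I_ne_zero (by exact_mod_cast h)
      have hyc : (y : ℂ) ≠ 0 := by exact_mod_cast h
      rw [intervalIntegral.integral_const_mul, integral_exp_mul_complex hc, Real.sinc_of_ne_zero h,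
        Complex.ofReal_div, Complex.ofReal_sin, Complex.sin]
      push_cast
      field_simp
      ring_nf
      simp [Complex.I_sq]

end IsBandlimited

/-- The Fourier transform of a function of `L²(D)` is bandlimited to `D`. -/
lemma isBandlimited_fourier {d : ℕ} {D : Set (E d)} (hD : IsCompact D) (h0 : 0 ∈ D)
    {f : Lp ℂ 2 (volume : Measure (E d))} (hf : f ∈ L2On D) :
    IsBandlimited D (𝓕 (f : E d → ℂ)) := by
  classical
  have hmeas := hD.isClosed.measurableSet
  -- Positions must lie in `D` everywhere, so points outside `D` are sent to `0`; the restricted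
  -- measure does not see them.
  refine ⟨E d, _, volume.restrict D, inferInstance, f, fun x => if x ∈ D then x else 0, ?_,
    Measurable.ite hmeas measurable_id measurable_const, fun x => by beta_reduce; split_ifs <;> assumption,
    fun ξ => ?_⟩
  · have : Fact (volume D < ∞) := ⟨hD.measure_lt_top⟩
    exact ((Lp.memLp f).restrict D).integrable one_le_two
  · rw [Real.fourier_eq', ← setIntegral_eq_integral_of_ae_compl_eq_zero (s := D)]
    · refine setIntegral_congr_fun hmeas fun x hx => ?_
      simp only [if_pos hx, smul_eq_mul]
      rw [mul_comm, mul_comm Complex.I]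
      congr 4
      ring
    · filter_upwards [show ∀ᵐ x, x ∉ D → f x = 0 from hf] with x hx hxD
      rw [hx hxD, smul_zero]

/-! ### Localizers -/

lemma abs_sinc_le_inv_abs {y : ℝ} (hy : y ≠ 0) : |Real.sinc y| ≤ |y|⁻¹ := by
  rw [Real.sinc_of_ne_zero hy, abs_div, div_eq_mul_inv]
  exact mul_le_of_le_one_left (by positivity) (Real.abs_sin_le_one y)

/-- The largest coordinate works, with `d + 1` a crude substitute for `√d`. The condition `x ≠ 0`
excludes `d = 0`, where there is no coordinate to choose. -/
lemma exists_norm_le_mul_abs_apply {d : ℕ} {x : E d} (hx : x ≠ 0) :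
    ∃ j, ‖x‖ ≤ (d + 1) * |x j| := by
  have hne : Nonempty (Fin d) := by
    by_contra h
    rw [not_nonempty_iff] at h
    exact hx (Subsingleton.elim _ _)
  obtain ⟨j, hj⟩ := Finite.exists_max fun j => |x j|
  refine ⟨j, ?_⟩
  rw [EuclideanSpace.norm_eq]
  refine Real.sqrt_le_iff.2 ⟨by positivity, ?_⟩
  calc ∑ i, ‖x i‖ ^ 2 ≤ ∑ _i : Fin d, |x j| ^ 2 := by
        refine Finset.sum_le_sum fun i _ => ?_
        rw [Real.norm_eq_abs]
        exact pow_le_pow_left₀ (abs_nonneg _) (hj i) 2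
    _ = d * |x j| ^ 2 := by simp
    _ ≤ ((d + 1) * |x j|) ^ 2 := by
        rw [mul_pow]
        refine mul_le_mul_of_nonneg_right ?_ (by positivity)
        have : (0 : ℝ) ≤ d := by positivity
        nlinarith

/-- Tensor products of powers of `sinc`: bandlimited functions with polynomial decay that are
exponentially small (in `M`) outside the ball of radius `M`. -/
theorem exists_bandlimited_localizer (d : ℕ) {r : ℝ} (hr : 0 < r) :
    ∃ c C : ℝ, 0 < c ∧ 0 < C ∧ ∀ M : ℝ, 0 < M → ∃ h : E d → ℂ,
      IsBandlimited (Metric.closedBall 0 r) h ∧ h 0 = 1 ∧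
      (∀ x, ‖h x‖ ≤ C * ((1 + ‖x‖) ^ (d + 1))⁻¹) ∧
      ∀ x, M ≤ ‖x‖ → ‖h x‖ ≤ C * Real.exp (-c * M) * ((1 + ‖x‖) ^ (d + 1))⁻¹ := by
  have hpi := Real.pi_pos
  -- Bandwidth budget: in each coordinate the `d + 1` factors of width `b₀` use `r / (2 (d + 1))`,
  -- and the `N` factors of width `b₁` use at most as much.
  set b₀ : ℝ := r / (2 * (d + 1) ^ 2) with hb₀
  have hb₀pos : 0 < b₀ := by positivity
  set A : ℝ := 2 * Real.pi * b₀ / (d + 1) with hA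
  have hApos : 0 < A := by positivity
  -- Chosen so that `2π b₁ M / (d + 1) = 3 κ M / N ≥ 3 > e`: each of the `N` narrow factors then
  -- gains at least `exp (-1)` beyond distance `M`. If `N = 0`, division by zero gives `b₁ = 0` and
  -- the power is `1`.
  set κ : ℝ := Real.pi * r / ((d + 1) ^ 2 * 3) with hκ
  have hκpos : 0 < κ := by positivity
  refine ⟨κ, (1 + A⁻¹) ^ (d + 1) * Real.exp 1, hκpos, by positivity, fun M hM => ?_⟩
  set N : ℕ := ⌊κ * M⌋₊ with hN
  set b₁ : ℝ := r / (2 * (d + 1) * N) with hb₁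
  have hb₁0 : 0 ≤ b₁ := by positivity
  have hNb : N * b₁ ≤ r / (2 * (d + 1)) := by
    rcases eq_or_ne N 0 with h | h
    · rw [h, Nat.cast_zero, zero_mul]; positivity
    · have : (N : ℝ) ≠ 0 := by exact_mod_cast h
      rw [hb₁]; apply le_of_eq; field_simp
  set g : Fin d → E d → ℂ := fun i x =>
    (Real.sinc (2 * Real.pi * b₀ * x i) : ℂ) ^ (d + 1) *
      (Real.sinc (2 * Real.pi * b₁ * x i) : ℂ) ^ N with hg
  have hgn : ∀ i x, ‖g i x‖ = |Real.sinc (2 * Real.pi * b₀ * x i)| ^ (d + 1) *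
      |Real.sinc (2 * Real.pi * b₁ * x i)| ^ N := by
    intro i x
    simp only [hg, norm_mul, norm_pow, Complex.norm_real, Real.norm_eq_abs]
  have hg1 : ∀ i x, ‖g i x‖ ≤ 1 := by
    intro i x
    rw [hgn]
    exact mul_le_one₀ (pow_le_one₀ (abs_nonneg _) (Real.abs_sinc_le_one _)) (by positivity)
      (pow_le_one₀ (abs_nonneg _) (Real.abs_sinc_le_one _))
  have hprod : ∀ j x, ‖∏ i, g i x‖ ≤ ‖g j x‖ := by
    intro j x
    rw [norm_prod, ← Finset.mul_prod_erase _ _ (Finset.mem_univ j)]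
    exact mul_le_of_le_one_right (norm_nonneg _)
      (Finset.prod_le_one (fun _ _ => norm_nonneg _) fun i _ => hg1 i x)
  have hexp : 1 ≤ Real.exp 1 := Real.one_le_exp zero_le_one
  have hA1 : 1 ≤ 1 + A⁻¹ := by have : 0 < A⁻¹ := by positivity
                               linarith
  have hdecay : ∀ {x : E d} {j : Fin d}, x ≠ 0 → ‖x‖ ≤ (d + 1) * |x j| →
      |Real.sinc (2 * Real.pi * b₀ * x j)| ≤ (1 + A⁻¹) * (1 + ‖x‖)⁻¹ := by
    intro x j hx hj
    have hxp : 0 < ‖x‖ := norm_pos_iff.2 hx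
    have hAx : A * ‖x‖ ≤ |2 * Real.pi * b₀ * x j| := by
      rw [abs_mul, abs_of_pos (by positivity : 0 < 2 * Real.pi * b₀), hA, div_mul_eq_mul_div,
        div_le_iff₀ (by positivity)]
      nlinarith [mul_le_mul_of_nonneg_left hj (by positivity : 0 ≤ 2 * Real.pi * b₀)]
    have hne : 2 * Real.pi * b₀ * x j ≠ 0 := by
      rw [← abs_pos]; exact lt_of_lt_of_le (by positivity) hAx
    have h1 : |Real.sinc (2 * Real.pi * b₀ * x j)| ≤ (A * ‖x‖)⁻¹ :=
      (abs_sinc_le_inv_abs hne).trans (inv_anti₀ (by positivity) hAx)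
    rw [← div_eq_mul_inv, le_div_iff₀ (by positivity), mul_add, mul_one]
    refine add_le_add (Real.abs_sinc_le_one _) ?_
    calc _ ≤ (A * ‖x‖)⁻¹ * ‖x‖ := by gcongr
      _ = A⁻¹ := by field_simp
  refine ⟨fun x => ∏ i, g i x, ?_, ?_, fun x => ?_, fun x hMx => ?_⟩
  · have h1 : ∀ i ∈ Finset.univ, IsBandlimited
        (Metric.closedBall 0 (((d + 1 : ℕ) : ℝ) * b₀ + N * b₁)) (g i) := fun i _ =>
      ((IsBandlimited.sinc hb₀pos.le i).pow_closedBall (d + 1)).mul_closedBall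
        ((IsBandlimited.sinc hb₁0 i).pow_closedBall N)
    refine (IsBandlimited.prod_closedBall Finset.univ h1).mono (Metric.closedBall_subset_closedBall ?_)
    rw [Finset.card_univ, Fintype.card_fin]
    have h2 : ((d + 1 : ℕ) : ℝ) * b₀ = r / (2 * (d + 1)) := by
      rw [hb₀]; push_cast; field_simp
    rw [h2]
    calc (d : ℝ) * (r / (2 * (d + 1)) + N * b₁)
        ≤ d * (r / (2 * (d + 1)) + r / (2 * (d + 1))) := by gcongr
      _ = r * (d / (d + 1)) := by field_simp; ring
      _ ≤ r := mul_le_of_le_one_right hr.le (div_le_one_of_le₀ (by linarith) (by positivity))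
  · simp [hg]
  · rcases eq_or_ne x 0 with rfl | hx
    · refine (show ‖∏ i, g i 0‖ ≤ 1 by simp [hg]).trans ?_
      simpa using one_le_mul_of_one_le_of_one_le (one_le_pow₀ hA1) hexp
    · obtain ⟨j, hj⟩ := exists_norm_le_mul_abs_apply hx
      refine (hprod j x).trans ?_
      rw [hgn]
      calc _ ≤ ((1 + A⁻¹) * (1 + ‖x‖)⁻¹) ^ (d + 1) * 1 := by
            gcongr
            · exact hdecay hx hj
            · exact pow_le_one₀ (abs_nonneg _) (Real.abs_sinc_le_one _)
        _ = (1 + A⁻¹) ^ (d + 1) * 1 * ((1 + ‖x‖) ^ (d + 1))⁻¹ := by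
            rw [mul_pow, inv_pow]; ring
        _ ≤ _ := by gcongr
  · have hx : x ≠ 0 := norm_pos_iff.1 (hM.trans_le hMx)
    obtain ⟨j, hj⟩ := exists_norm_le_mul_abs_apply hx
    refine (hprod j x).trans ?_
    have hsmall : |Real.sinc (2 * Real.pi * b₁ * x j)| ^ N ≤ Real.exp 1 * Real.exp (-κ * M) := by
      have h1 : |Real.sinc (2 * Real.pi * b₁ * x j)| ^ N ≤ Real.exp (-N) := by
        rcases Nat.eq_zero_or_pos N with h | h
        · rw [h]; simp
        · have hNpos : (0 : ℝ) < N := by exact_mod_cast h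
          have hNM : N ≤ κ * M := Nat.floor_le (by positivity)
          have h3 : 3 ≤ |2 * Real.pi * b₁ * x j| := by
            rw [abs_mul, abs_of_nonneg (by positivity : 0 ≤ 2 * Real.pi * b₁)]
            have h4 : M / (d + 1) ≤ |x j| := by
              rw [div_le_iff₀ (by positivity)]; linarith
            calc (3 : ℝ) = 3 * N / N := by field_simp
              _ ≤ 3 * (κ * M) / N := by gcongr
              _ = 2 * Real.pi * b₁ * (M / (d + 1)) := by
                  rw [hκ, hb₁]; field_simp
              _ ≤ _ := by gcongr
          have h5 : |Real.sinc (2 * Real.pi * b₁ * x j)| ≤ Real.exp (-1) := by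
            refine (abs_sinc_le_inv_abs (abs_pos.1 (by linarith))).trans ?_
            rw [Real.exp_neg]
            exact inv_anti₀ (Real.exp_pos _) (Real.exp_one_lt_d9.le.trans (by linarith))
          calc _ ≤ Real.exp (-1) ^ N := by gcongr
            _ = Real.exp (-N) := by rw [← Real.exp_nat_mul]; ring_nf
      refine h1.trans ?_
      rw [← Real.exp_add]
      refine Real.exp_le_exp.2 ?_
      -- Rounding `κ M` down to `N` costs at most the factor `exp 1`.
      have := Nat.lt_floor_add_one (κ * M)
      linarith
    rw [hgn]
    calc _ ≤ ((1 + A⁻¹) * (1 + ‖x‖)⁻¹) ^ (d + 1) * (Real.exp 1 * Real.exp (-κ * M)) := by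
          gcongr
          exact hdecay hx hj
      _ = _ := by rw [mul_pow, inv_pow]; ring

/-! ### Plancherel for the pointwise Fourier integral -/

section Plancherel

variable {d : ℕ}

/-- On `L¹ ∩ L²` the Fourier transform of `L²` is given by the Fourier integral. -/
lemma coeFn_fourier_ae_eq {f : Lp ℂ 2 (volume : Measure (E d))} (hf : Integrable f) :
    (𝓕 f : Lp ℂ 2 (volume : Measure (E d))) =ᵐ[volume] 𝓕 (f : E d → ℂ) := by
  have hc : Continuous (𝓕 (f : E d → ℂ)) :=
    VectorFourier.fourierIntegral_continuous Real.continuous_fourierChar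
      (by exact continuous_inner) hf
  refine ae_eq_of_integral_contDiff_smul_eq
    ((Lp.memLp (𝓕 f)).locallyIntegrable one_le_two) hc.locallyIntegrable fun g hg hgc => ?_
  have hgc' : HasCompactSupport (fun x => (g x : ℂ)) := hgc.comp_left Complex.ofReal_zero
  set G := hgc'.toSchwartzMap (Complex.ofRealCLM.contDiff.comp hg) with hG
  have hGx : ∀ x, G x = (g x : ℂ) := fun x => rfl
  -- The `L²` transform agrees with the distributional one; on test functions, the transform is
  -- moved back onto `f` by self-adjointness.
  have h1 := congrArg (fun T => T G) (Lp.fourier_toTemperedDistribution_eq f)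
  simp only [TemperedDistribution.fourier_apply, Lp.toTemperedDistribution_apply] at h1
  have h2 : ∫ ξ, 𝓕 (G : E d → ℂ) ξ • f ξ = ∫ x, G x • 𝓕 (f : E d → ℂ) x := by
    have := VectorFourier.integral_fourierIntegral_smul_eq_flip (μ := volume) (ν := volume)
      (L := innerₗ (E d)) (f := (G : E d → ℂ)) (g := (f : E d → ℂ)) Real.continuous_fourierChar
      (by exact continuous_inner) G.integrable hf
    rw [flip_innerₗ] at this
    exact this
  rw [SchwartzMap.fourier_coe, h2] at h1
  simp only [hGx] at h1
  simpa using h1.symm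

lemma lintegral_fourier_enorm_sq {f : Lp ℂ 2 (volume : Measure (E d))} (hf : Integrable f) :
    ∫⁻ ξ, ‖𝓕 (f : E d → ℂ) ξ‖ₑ ^ 2 = ‖f‖ₑ ^ 2 := by
  have h : ‖(𝓕 f : Lp ℂ 2 (volume : Measure (E d)))‖ₑ = ‖f‖ₑ := by
    rw [← ofReal_norm, ← ofReal_norm, Lp.norm_fourier_eq]
  rw [← h, Lp.enorm_def, eLpNorm_eq_lintegral_rpow_enorm_toReal two_ne_zero ENNReal.ofNat_ne_top]
  rw [ENNReal.toReal_ofNat, one_div, ← ENNReal.rpow_natCast (_ ^ _), ← ENNReal.rpow_mul]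
  norm_num
  refine lintegral_congr_ae ?_
  filter_upwards [coeFn_fourier_ae_eq hf] with x hx
  rw [hx]

lemma integrable_of_mem_L2On {D : Set (E d)} (hD : IsCompact D)
    {f : Lp ℂ 2 (volume : Measure (E d))} (hf : f ∈ L2On D) : Integrable f := by
  have : Fact (volume D < ∞) := ⟨hD.measure_lt_top⟩
  have h : IntegrableOn f D := ((Lp.memLp f).restrict D).integrable one_le_two
  refine h.integrable_of_ae_notMem_eq_zero ?_
  exact hf

end Plancherel

/-! ### The polar norm -/

namespace IsCenteredSymmetricConvexBody

variable {d : ℕ} {D : Set (E d)}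

lemma zero_mem (hD : IsCenteredSymmetricConvexBody D) : 0 ∈ D := interior_subset hD.zero_mem_interior

lemma exists_closedBall_subset (hD : IsCenteredSymmetricConvexBody D) :
    ∃ ρ > 0, Metric.closedBall 0 ρ ⊆ D :=
  Metric.nhds_basis_closedBall.mem_iff.1 (mem_interior_iff_mem_nhds.1 hD.zero_mem_interior)

lemma exists_subset_closedBall (hD : IsCenteredSymmetricConvexBody D) :
    ∃ R > 0, D ⊆ Metric.closedBall 0 R :=
  hD.isCompact.isBounded.subset_closedBall_lt 0 0 |>.imp fun _ h => h

end IsCenteredSymmetricConvexBody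

section Gauge

variable {d : ℕ} {D : Set (E d)} {R ρ : ℝ}

lemma convex_polarSet : Convex ℝ (polarSet D) := by
  intro x hx y hy a b ha hb hab z hz
  rw [inner_add_right, inner_smul_right, inner_smul_right]
  calc _ ≤ a * 1 + b * 1 := by gcongr; exacts [hx z hz, hy z hz]
    _ = 1 := by linarith

lemma ball_subset_polarSet (hR : 0 < R) (hDR : D ⊆ Metric.closedBall 0 R) :
    Metric.ball 0 R⁻¹ ⊆ polarSet D := by
  intro z hz x hx
  rw [mem_ball_zero_iff] at hz
  have hx' := mem_closedBall_zero_iff.1 (hDR hx)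
  calc inner ℝ x z ≤ ‖x‖ * ‖z‖ := real_inner_le_norm _ _
    _ ≤ R * R⁻¹ := by gcongr
    _ = 1 := mul_inv_cancel₀ hR.ne'

lemma polarSet_mem_nhds_zero (hb : Bornology.IsBounded D) : polarSet D ∈ nhds 0 := by
  obtain ⟨R, hR, h⟩ := hb.subset_closedBall_lt 0 0
  exact Filter.mem_of_superset (Metric.ball_mem_nhds 0 (inv_pos.2 hR)) (ball_subset_polarSet hR h)

lemma continuous_gauge_polarSet (hb : Bornology.IsBounded D) : Continuous (gauge (polarSet D)) :=
  continuous_gauge convex_polarSet (polarSet_mem_nhds_zero hb)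

lemma gauge_polarSet_le (hR : 0 < R) (hDR : D ⊆ Metric.closedBall 0 R) (v : E d) :
    gauge (polarSet D) v ≤ R * ‖v‖ := by
  have := mul_gauge_le_norm (ball_subset_polarSet hR hDR) (x := v)
  rwa [inv_mul_le_iff₀ hR] at this

lemma gauge_polarSet_add_le (hb : Bornology.IsBounded D) (v w : E d) :
    gauge (polarSet D) (v + w) ≤ gauge (polarSet D) v + gauge (polarSet D) w :=
  gauge_add_le convex_polarSet (absorbent_nhds_zero (polarSet_mem_nhds_zero hb)) v w

/-- Duality between `D` and its polar norm: this turns a gap condition into a bound on phases. -/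
lemma inner_le_gauge_polarSet (hb : Bornology.IsBounded D) {x : E d} (hx : x ∈ D) (v : E d) :
    inner ℝ x v ≤ gauge (polarSet D) v := by
  refine le_csInf (absorbent_nhds_zero (polarSet_mem_nhds_zero hb)).gauge_set_nonempty ?_
  rintro r ⟨hr, z, hz, rfl⟩
  beta_reduce
  rw [inner_smul_right]
  exact mul_le_of_le_one_right (le_of_lt hr) (hz x hx)

lemma abs_inner_le_gauge_polarSet (hb : Bornology.IsBounded D) (hs : -D = D) {x : E d}
    (hx : x ∈ D) (v : E d) : |inner ℝ x v| ≤ gauge (polarSet D) v := by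
  refine abs_le'.2 ⟨inner_le_gauge_polarSet hb hx v, ?_⟩
  rw [← inner_neg_left]
  exact inner_le_gauge_polarSet hb (by rw [← hs]; simpa using hx) v

lemma norm_le_gauge_polarSet (hb : Bornology.IsBounded D) (hρ : 0 < ρ)
    (hDρ : Metric.closedBall 0 ρ ⊆ D) (v : E d) : ρ * ‖v‖ ≤ gauge (polarSet D) v := by
  rcases eq_or_ne v 0 with rfl | hv
  · simp
  have hv' := norm_pos_iff.2 hv
  have hx : (ρ / ‖v‖) • v ∈ D := hDρ (by
    rw [mem_closedBall_zero_iff, norm_smul, Real.norm_of_nonneg (by positivity)]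
    field_simp
    rfl)
  refine le_trans (le_of_eq ?_) (inner_le_gauge_polarSet hb hx v)
  rw [inner_smul_left, real_inner_self_eq_norm_sq]
  simp
  field_simp

end Gauge

/-! ### Gaps and Voronoi regions -/

section Voronoi

variable {d : ℕ} {D B Ω : Set (E d)} {δ δ' : ℝ}

lemma exists_gauge_lt_of_gap_le (h : gap B Ω ≤ ENNReal.ofReal δ) (h0 : 0 ≤ δ) (hδ : δ < δ')
    (z : E d) : ∃ ω ∈ Ω, gauge B (ω - z) < δ' := by
  have h1 : (⨅ ω ∈ Ω, ENNReal.ofReal (gauge B (ω - z))) < ENNReal.ofReal δ' :=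
    ((le_iSup (fun z : E d => ⨅ ω ∈ Ω, ENNReal.ofReal (gauge B (ω - z))) z).trans h).trans_lt
      ((ENNReal.ofReal_lt_ofReal_iff (h0.trans_lt hδ)).2 hδ)
  simp only [iInf_lt_iff] at h1
  obtain ⟨ω, hω, h2⟩ := h1
  exact ⟨ω, hω, (ENNReal.ofReal_lt_ofReal_iff (h0.trans_lt hδ)).1 h2⟩

lemma gauge_le_of_mem_voronoiRegion {ω v z : E d} (hz : z ∈ voronoiRegion B Ω ω) (hv : v ∈ Ω) :
    gauge B (ω - z) ≤ gauge B (v - z) := by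
  rcases eq_or_ne v ω with rfl | h
  · exact le_rfl
  · exact hz v hv h

/-- The site of a cell is at least as near as any other sample. The infimum in the gap need not be
attained, so one passes through every `δ' > δ`. -/
lemma gauge_le_of_gap_le (h : gap B Ω ≤ ENNReal.ofReal δ) (h0 : 0 ≤ δ) {ω z : E d}
    (hz : z ∈ voronoiRegion B Ω ω) : gauge B (ω - z) ≤ δ := by
  refine le_of_forall_gt_imp_ge_of_dense fun δ' hδ => ?_
  obtain ⟨v, hv, h⟩ := exists_gauge_lt_of_gap_le h h0 hδ z
  exact (gauge_le_of_mem_voronoiRegion hz hv).trans h.le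

lemma isClosed_voronoiRegion (hb : Bornology.IsBounded D) (ω : E d) :
    IsClosed (voronoiRegion (polarSet D) Ω ω) := by
  have hc := continuous_gauge_polarSet hb
  simp only [voronoiRegion, Set.ofPred_forall]
  refine isClosed_iInter fun v => isClosed_iInter fun _ => isClosed_iInter fun _ =>
    isClosed_le (by fun_prop) (by fun_prop)

/-- A nearest sample exists: those no farther from `z` than a fixed sample `ω₀` lie in a compact
part of the closed set. -/
lemma exists_mem_voronoiRegion (hD : IsCenteredSymmetricConvexBody D) (hΩ : IsClosed Ω)
    (hne : Ω.Nonempty) (z : E d) : ∃ ω ∈ Ω, z ∈ voronoiRegion (polarSet D) Ω ω := by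
  have hb := hD.isCompact.isBounded
  obtain ⟨ρ, hρ, hDρ⟩ := hD.exists_closedBall_subset
  obtain ⟨ω₀, hω₀⟩ := hne
  have hc : Continuous fun ω => gauge (polarSet D) (ω - z) :=
    (continuous_gauge_polarSet hb).comp (by fun_prop)
  set t := gauge (polarSet D) (ω₀ - z)
  have hcomp : IsCompact (Ω ∩ Metric.closedBall z (t / ρ)) :=
    (isCompact_closedBall _ _).inter_left hΩ
  have hmem : ∀ ω ∈ Ω, gauge (polarSet D) (ω - z) ≤ t → ω ∈ Ω ∩ Metric.closedBall z (t / ρ) := by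
    intro ω hω h
    refine ⟨hω, ?_⟩
    rw [mem_closedBall_iff_norm, le_div_iff₀' hρ]
    exact (norm_le_gauge_polarSet hb hρ hDρ _).trans h
  obtain ⟨ω, hω, hmin⟩ := hcomp.exists_isMinOn ⟨ω₀, hmem _ hω₀ le_rfl⟩ hc.continuousOn
  refine ⟨ω, hω.1, fun v hv _ => ?_⟩
  rcases le_total (gauge (polarSet D) (v - z)) t with h | h
  · exact hmin (hmem v hv h)
  · exact (hmin (hmem ω₀ hω₀ le_rfl)).trans h

lemma nonempty_of_gap_le (h : gap B Ω ≤ ENNReal.ofReal δ) : Ω.Nonempty := by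
  by_contra hne
  rw [not_nonempty_iff_eq_empty] at hne
  subst hne
  simp [gap] at h

end Voronoi

/-- A countable measurable cover can be shrunk to a disjoint one. -/
lemma exists_disjoint_measurable_subcover {ι X : Type*} [Countable ι] [MeasurableSpace X]
    {V : ι → Set X} (hV : ∀ i, MeasurableSet (V i)) (hcov : ∀ z, ∃ i, z ∈ V i) :
    ∃ W : ι → Set X, (∀ i, MeasurableSet (W i)) ∧ (∀ i, W i ⊆ V i) ∧
      Pairwise (Function.onFun Disjoint W) ∧ ∀ z, ∃ i, z ∈ W i := by
  obtain ⟨e, he⟩ := Countable.exists_injective_nat ι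
  -- Each point goes to the first set containing it, in the order pulled back from `ℕ`.
  refine ⟨fun i => V i \ ⋃ (j) (_ : e j < e i), V j, fun i => (hV i).diff
    (.iUnion fun j => .iUnion fun _ => hV j), fun i => sdiff_subset, fun i j hij => ?_, fun z => ?_⟩
  · rw [Function.onFun, Set.disjoint_left]
    rintro z ⟨h1, h2⟩ ⟨h3, h4⟩
    simp only [mem_iUnion, not_exists] at h2 h4
    rcases lt_or_gt_of_ne (he.ne hij) with h | h
    · exact h4 i h h1
    · exact h2 j h h3
  · obtain ⟨i, hi, hmin⟩ := WellFounded.has_min (InvImage.wf e Nat.lt_wfRel.wf)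
      {i | z ∈ V i} (hcov z)
    refine ⟨i, hi, ?_⟩
    simp only [mem_iUnion, not_exists]
    exact fun j hj hz => hmin j hz hj

/-! ### Sup bounds by continuous and sampled energies -/

lemma exists_norm_le_norm_of_tendsto_zero {X : Type*} [TopologicalSpace X] [Nonempty X]
    {F : X → ℂ} (hF : Continuous F) (h0 : Filter.Tendsto F (Filter.cocompact X) (nhds 0)) :
    ∃ z, ∀ x, ‖F x‖ ≤ ‖F z‖ := by
  by_cases h : ∃ x, F x ≠ 0
  · obtain ⟨x, hx⟩ := h
    refine hF.norm.exists_forall_ge' x ?_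
    have := h0.norm
    rw [norm_zero] at this
    exact (this.eventually_lt_const (norm_pos_iff.2 hx)).mono fun _ h => h.le
  · push Not at h
    exact ⟨Classical.arbitrary X, fun x => by simp [h]⟩

lemma enorm_sq_le_of_mul_norm_le {c : ℝ} (hc : 0 < c) {x y : ℂ} (h : c * ‖x‖ ≤ ‖y‖) :
    ‖x‖ₑ ^ 2 ≤ ENNReal.ofReal (c⁻¹ ^ 2) * ‖y‖ₑ ^ 2 := by
  rw [← ofReal_norm, ← ofReal_norm, ← ENNReal.ofReal_pow (norm_nonneg _),
    ← ENNReal.ofReal_pow (norm_nonneg _), ← ENNReal.ofReal_mul (by positivity), ← mul_pow]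
  refine ENNReal.ofReal_le_ofReal (pow_le_pow_left₀ (norm_nonneg _) ?_ 2)
  rwa [← div_eq_inv_mul, le_div_iff₀' hc]

variable {d : ℕ}

/-- A bandlimited function is bounded by its `L²` norm. -/
theorem exists_enorm_sq_le_lintegral (d : ℕ) {R : ℝ} (hR : 0 < R) :
    ∃ C : ℝ≥0∞, C ≠ ∞ ∧ ∀ F : E d → ℂ, IsBandlimited (Metric.closedBall 0 R) F →
      Filter.Tendsto F (Filter.cocompact (E d)) (nhds 0) →
      ∀ ω, ‖F ω‖ₑ ^ 2 ≤ C * ∫⁻ ξ, ‖F ξ‖ₑ ^ 2 := by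
  have hpi := Real.pi_pos
  -- Within `η` of the maximum all phases are at most `2π R η = π/3`, whose cosine is `1/2`.
  set η : ℝ := (6 * R)⁻¹ with hη
  have hηpos : 0 < η := by positivity
  set m := volume (Metric.ball (0 : E d) η) with hm
  have hm0 : m ≠ 0 := (Metric.measure_ball_pos _ _ hηpos).ne'
  have hmt : m ≠ ∞ := measure_ball_lt_top.ne
  refine ⟨m⁻¹ * ENNReal.ofReal ((1 / 2 : ℝ)⁻¹ ^ 2), ENNReal.mul_ne_top (ENNReal.inv_ne_top.2 hm0)
    ENNReal.ofReal_ne_top, fun F hF hF0 ω => ?_⟩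
  obtain ⟨z, hz⟩ := exists_norm_le_norm_of_tendsto_zero hF.continuous hF0
  have hball : ∀ x ∈ Metric.ball z η,
      ‖F z‖ₑ ^ 2 ≤ ENNReal.ofReal ((1 / 2 : ℝ)⁻¹ ^ 2) * ‖F x‖ₑ ^ 2 := by
    intro x hx
    refine enorm_sq_le_of_mul_norm_le (by norm_num) ?_
    rw [mem_ball_iff_norm] at hx
    have := hF.cos_mul_norm_le (v := x - z) hz (τ := Real.pi / 3) (by positivity) (by linarith)
      fun p hp => ?_
    · rwa [Real.cos_pi_div_three, add_sub_cancel] at this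
    · rw [mem_closedBall_zero_iff] at hp
      rw [abs_mul, abs_of_pos (by positivity : 0 < 2 * Real.pi)]
      calc 2 * Real.pi * |inner ℝ p (x - z)| ≤ 2 * Real.pi * (‖p‖ * ‖x - z‖) := by
            gcongr; exact abs_real_inner_le_norm _ _
        _ ≤ 2 * Real.pi * (R * η) := by gcongr
        _ = Real.pi / 3 := by rw [hη]; field_simp; norm_num
  calc ‖F ω‖ₑ ^ 2 ≤ ‖F z‖ₑ ^ 2 := by
        gcongr
        rw [← ofReal_norm, ← ofReal_norm]
        exact ENNReal.ofReal_le_ofReal (hz ω)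
    _ = m⁻¹ * ∫⁻ _ in Metric.ball z η, ‖F z‖ₑ ^ 2 := by
        rw [setLIntegral_const, mul_comm (_ ^ 2), ← mul_assoc, hm,
          Measure.addHaar_ball_center volume z η, ENNReal.inv_mul_cancel hm0 hmt, one_mul]
    _ ≤ m⁻¹ * ∫⁻ x in Metric.ball z η, ENNReal.ofReal ((1 / 2 : ℝ)⁻¹ ^ 2) * ‖F x‖ₑ ^ 2 := by
        gcongr 1
        exact setLIntegral_mono' Metric.isOpen_ball.measurableSet hball
    _ ≤ m⁻¹ * ∫⁻ x, ENNReal.ofReal ((1 / 2 : ℝ)⁻¹ ^ 2) * ‖F x‖ₑ ^ 2 := by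
        gcongr 1
        exact setLIntegral_le_lintegral _ _
    _ = _ := by
        rw [lintegral_const_mul' _ _ ENNReal.ofReal_ne_top, mul_assoc]

open scoped Pointwise in
/-- Below the critical density, a bandlimited function is bounded by its weighted `ℓ²` norm on the
sampling points. -/
theorem exists_enorm_sq_le_tsum {D : Set (E d)} (hD : IsCenteredSymmetricConvexBody D) {ε : ℝ}
    (hε0 : 0 < ε) (hε1 : ε < 1) :
    ∃ r > 0, ∃ C : ℝ≥0∞, C ≠ ∞ ∧ ∀ F : E d → ℂ, IsBandlimited (D + Metric.closedBall 0 r) F →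
      Filter.Tendsto F (Filter.cocompact (E d)) (nhds 0) →
      ∀ (ι : Type) [Countable ι] (x : ι → E d) (W : ι → Set (E d)),
        (∀ z, ∃ i, z ∈ W i) → (∀ i, ∀ z ∈ W i, gauge (polarSet D) (x i - z) ≤ 1 / 4 * (1 - ε)) →
        ∀ ξ, ‖F ξ‖ₑ ^ 2 ≤ C * ∑' i, volume (W i) * ‖F (x i)‖ₑ ^ 2 := by
  have hpi := Real.pi_pos
  have hb := hD.isCompact.isBounded
  obtain ⟨ρ, hρ, hDρ⟩ := hD.exists_closedBall_subset
  obtain ⟨R, hR, hDR⟩ := hD.exists_subset_closedBall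
  -- A displacement `η` costs `ε/16` in polar norm, leaving `(1 - 3ε/4)/4`; enlarging the spectrum
  -- by `r` below costs a factor `1 + ε/4`. Together they stay within `(1 - ε/2)/4`, which is `τ /
  -- (2π)`.
  set η : ℝ := ε / (16 * R) with hη
  have hηpos : 0 < η := by positivity
  set r : ℝ := ρ * (ε / 4) with hr
  have hrpos : 0 < r := by positivity
  set τ : ℝ := Real.pi / 2 * (1 - ε / 2) with hτ
  have hτ0 : 0 < τ := mul_pos (by positivity) (by linarith)
  have hτ2 : τ < Real.pi / 2 := by nlinarith
  have hcos : 0 < Real.cos τ := Real.cos_pos_of_mem_Ioo ⟨by linarith, hτ2⟩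
  set m := volume (Metric.ball (0 : E d) η) with hm
  have hm0 : m ≠ 0 := (Metric.measure_ball_pos _ _ hηpos).ne'
  have hmt : m ≠ ∞ := measure_ball_lt_top.ne
  refine ⟨r, hrpos, m⁻¹ * ENNReal.ofReal ((Real.cos τ)⁻¹ ^ 2), ENNReal.mul_ne_top
    (ENNReal.inv_ne_top.2 hm0) ENNReal.ofReal_ne_top, fun F hF hF0 ι _ x W hcov hW ξ => ?_⟩
  obtain ⟨z, hz⟩ := exists_norm_le_norm_of_tendsto_zero hF.continuous hF0
  have hnear : ∀ i, ∀ z' ∈ W i ∩ Metric.ball z η,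
      ‖F z‖ₑ ^ 2 ≤ ENNReal.ofReal ((Real.cos τ)⁻¹ ^ 2) * ‖F (x i)‖ₑ ^ 2 := by
    rintro i z' ⟨hz'W, hz'⟩
    refine enorm_sq_le_of_mul_norm_le hcos ?_
    rw [mem_ball_iff_norm] at hz'
    have hg : gauge (polarSet D) (x i - z) ≤ (1 - 3 * ε / 4) / 4 := by
      have h1 := gauge_polarSet_add_le hb (x i - z') (z' - z)
      rw [sub_add_sub_cancel] at h1
      have h2 := gauge_polarSet_le hR hDR (z' - z)
      have h3 : R * ‖z' - z‖ ≤ ε / 16 := by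
        calc R * ‖z' - z‖ ≤ R * η := by gcongr
          _ = ε / 16 := by rw [hη]; field_simp
      linarith [hW i z' hz'W]
    have := hF.cos_mul_norm_le (v := x i - z) hz hτ0 (by linarith) fun p hp => ?_
    · rwa [add_sub_cancel] at this
    · obtain ⟨p₁, hp₁, p₂, hp₂, rfl⟩ := hp
      rw [mem_closedBall_zero_iff] at hp₂
      rw [abs_mul, abs_of_pos (by positivity : 0 < 2 * Real.pi), inner_add_left]
      have h1 := abs_inner_le_gauge_polarSet hb hD.symm hp₁ (x i - z)
      have h2 : |inner ℝ p₂ (x i - z)| ≤ ε / 4 * gauge (polarSet D) (x i - z) := by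
        calc _ ≤ ‖p₂‖ * ‖x i - z‖ := abs_real_inner_le_norm _ _
          _ ≤ r * ‖x i - z‖ := by gcongr
          _ = ε / 4 * (ρ * ‖x i - z‖) := by rw [hr]; ring
          _ ≤ _ := by gcongr; exact norm_le_gauge_polarSet hb hρ hDρ _
      have h3 : |inner ℝ p₁ (x i - z) + inner ℝ p₂ (x i - z)| ≤ (1 - ε / 2) / 4 := by
        refine (abs_add_le _ _).trans ((add_le_add h1 h2).trans ?_)
        nlinarith [gauge_nonneg (s := polarSet D) (x i - z)]
      calc _ ≤ 2 * Real.pi * ((1 - ε / 2) / 4) := by gcongr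
        _ = τ := by rw [hτ]; ring
  -- Only subadditivity is needed, so overlapping cells are harmless here.
  have hcover : m ≤ ∑' i, volume (W i ∩ Metric.ball z η) := by
    rw [hm, ← Measure.addHaar_ball_center volume z η]
    refine (measure_mono fun y hy => ?_).trans (measure_iUnion_le _)
    obtain ⟨i, hi⟩ := hcov y
    exact mem_iUnion.2 ⟨i, hi, hy⟩
  calc ‖F ξ‖ₑ ^ 2 ≤ ‖F z‖ₑ ^ 2 := by
        gcongr
        rw [← ofReal_norm, ← ofReal_norm]
        exact ENNReal.ofReal_le_ofReal (hz ξ)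
    _ = m⁻¹ * (m * ‖F z‖ₑ ^ 2) := by
        rw [← mul_assoc, ENNReal.inv_mul_cancel hm0 hmt, one_mul]
    _ ≤ m⁻¹ * ∑' i, volume (W i ∩ Metric.ball z η) * ‖F z‖ₑ ^ 2 := by
        rw [ENNReal.tsum_mul_right]
        gcongr
    _ ≤ m⁻¹ * ∑' i, ENNReal.ofReal ((Real.cos τ)⁻¹ ^ 2) * (volume (W i) * ‖F (x i)‖ₑ ^ 2) := by
        gcongr 1
        refine ENNReal.tsum_le_tsum fun i => ?_
        rcases (W i ∩ Metric.ball z η).eq_empty_or_nonempty with h | ⟨z', hz'⟩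
        · rw [h]; simp
        · rw [mul_left_comm]
          exact mul_le_mul' (measure_mono inter_subset_left) (hnear i z' hz')
    _ = _ := by rw [ENNReal.tsum_mul_left, mul_assoc]

/-! ### Summing the localizers over samples -/

/-- The square of the decay profile of the localizers. -/
noncomputable def decayProfile {d : ℕ} (x : E d) : ℝ≥0∞ :=
  ENNReal.ofReal ((((1 + ‖x‖) ^ (d + 1))⁻¹) ^ 2)

lemma measurable_decayProfile : Measurable (decayProfile (d := d)) := by
  unfold decayProfile; fun_prop

lemma lintegral_decayProfile_ne_top : ∫⁻ x : E d, decayProfile x ≠ ∞ := by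
  have h := finite_integral_one_add_norm (μ := (volume : Measure (E d)))
    (r := ((2 * (d + 1) : ℕ) : ℝ)) (by
      rw [finrank_euclideanSpace_fin]; push_cast; linarith [(Nat.cast_nonneg d : (0 : ℝ) ≤ d)])
  refine ne_of_lt (lt_of_le_of_lt (lintegral_mono fun x => le_of_eq ?_) h)
  rw [decayProfile, Real.rpow_neg (by positivity), Real.rpow_natCast, inv_pow, ← pow_mul, mul_comm 2]

/-- From `1 + ‖y‖ ≤ (1 + r) * (1 + ‖x‖)`; it lets a sample be replaced by any point of its cell. -/
lemma decayProfile_le_of_norm_sub_le {r : ℝ} (hr : 0 ≤ r) {x y : E d} (h : ‖y - x‖ ≤ r) :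
    decayProfile x ≤ ENNReal.ofReal (((1 + r) ^ (d + 1)) ^ 2) * decayProfile y := by
  rw [decayProfile, decayProfile, ← ENNReal.ofReal_mul (by positivity), ← mul_pow]
  refine ENNReal.ofReal_le_ofReal (pow_le_pow_left₀ (by positivity) ?_ 2)
  rw [← inv_pow, ← inv_pow, ← mul_pow]
  refine pow_le_pow_left₀ (by positivity) ?_ _
  rw [← div_eq_mul_inv, inv_le_iff_one_le_mul₀ (by positivity), div_mul_eq_mul_div,
    one_le_div (by positivity)]
  have : ‖y‖ ≤ ‖x‖ + r := by
    have := norm_add_le x (y - x)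
    rw [add_sub_cancel] at this
    linarith
  nlinarith [norm_nonneg x]

/-- Sums of the decay profile over points carrying almost disjoint nearby sets of given measure
are bounded. -/
lemma exists_tsum_decayProfile_le (d : ℕ) {r : ℝ} (hr : 0 ≤ r) :
    ∃ C : ℝ≥0∞, C ≠ ∞ ∧ ∀ (ι : Type) [Countable ι] (x : ι → E d) (W : ι → Set (E d)),
      (∀ i, MeasurableSet (W i)) → Pairwise (fun i j => volume (W i ∩ W j) = 0) →
      (∀ i, W i ⊆ Metric.closedBall (x i) r) →
      ∀ ξ, ∑' i, volume (W i) * decayProfile (ξ - x i) ≤ C := by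
  refine ⟨ENNReal.ofReal (((1 + r) ^ (d + 1)) ^ 2) * ∫⁻ x : E d, decayProfile x,
    ENNReal.mul_ne_top ENNReal.ofReal_ne_top lintegral_decayProfile_ne_top,
    fun ι _ x W hW hdisj hsub ξ => ?_⟩
  have hmeas : Measurable fun z : E d => decayProfile (ξ - z) :=
    measurable_decayProfile.comp (by fun_prop)
  calc ∑' i, volume (W i) * decayProfile (ξ - x i)
      = ∑' i, ∫⁻ _ in W i, decayProfile (ξ - x i) := by
        simp_rw [setLIntegral_const, mul_comm]
    _ ≤ ∑' i, ∫⁻ z in W i, ENNReal.ofReal (((1 + r) ^ (d + 1)) ^ 2) * decayProfile (ξ - z) := by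
        refine ENNReal.tsum_le_tsum fun i => setLIntegral_mono' (hW i) fun z hz => ?_
        refine decayProfile_le_of_norm_sub_le hr ?_
        rw [sub_sub_sub_cancel_left, ← mem_closedBall_iff_norm']
        exact hsub i hz
    _ = ∫⁻ z in ⋃ i, W i, ENNReal.ofReal (((1 + r) ^ (d + 1)) ^ 2) * decayProfile (ξ - z) := by
        rw [lintegral_iUnion₀ (fun i => (hW i).nullMeasurableSet) fun i j hij => hdisj hij]
    _ ≤ ∫⁻ z, ENNReal.ofReal (((1 + r) ^ (d + 1)) ^ 2) * decayProfile (ξ - z) :=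
        setLIntegral_le_lintegral _ _
    _ = _ := by
        rw [lintegral_const_mul _ hmeas, lintegral_sub_left_eq_self (fun z => decayProfile z) ξ]

lemma exists_localizer_enorm_sq (d : ℕ) {r : ℝ} (hr : 0 < r) :
    ∃ c > 0, ∃ C : ℝ≥0∞, C ≠ ∞ ∧ ∀ M : ℝ, 0 < M → ∃ h : E d → ℂ,
      IsBandlimited (Metric.closedBall 0 r) h ∧ h 0 = 1 ∧
      Filter.Tendsto h (Filter.cocompact (E d)) (nhds 0) ∧
      (∀ x, ‖h x‖ₑ ^ 2 ≤ C * decayProfile x) ∧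
      ∀ x, M ≤ ‖x‖ → ‖h x‖ₑ ^ 2 ≤ C * ENNReal.ofReal (Real.exp (-c * M)) * decayProfile x := by
  obtain ⟨c, C, hc, hC, H⟩ := exists_bandlimited_localizer d hr
  refine ⟨c, hc, ENNReal.ofReal (C ^ 2), ENNReal.ofReal_ne_top, fun M hM => ?_⟩
  obtain ⟨h, hband, h0, hle, hfar⟩ := H M hM
  have hsq : ∀ {x : E d} {b : ℝ}, 0 ≤ b → ‖h x‖ ≤ b * ((1 + ‖x‖) ^ (d + 1))⁻¹ →
      ‖h x‖ₑ ^ 2 ≤ ENNReal.ofReal (b ^ 2) * decayProfile x := by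
    intro x b hb hx
    rw [decayProfile, ← ENNReal.ofReal_mul (by positivity), ← mul_pow, ← ofReal_norm,
      ← ENNReal.ofReal_pow (norm_nonneg _)]
    exact ENNReal.ofReal_le_ofReal (pow_le_pow_left₀ (norm_nonneg _) hx 2)
  refine ⟨h, hband, h0, ?_, fun x => hsq hC.le (hle x), fun x hx => ?_⟩
  · refine squeeze_zero_norm hle ?_
    rw [← mul_zero C]
    refine Filter.Tendsto.const_mul _ (Filter.Tendsto.inv_tendsto_atTop ?_)
    exact (Filter.tendsto_pow_atTop d.succ_ne_zero).comp
      (Filter.tendsto_atTop_add_const_left _ 1 (tendsto_norm_cocompact_atTop (E := E d)))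
  · refine (hsq (by positivity) (hfar x hx)).trans ?_
    rw [← ENNReal.ofReal_mul (by positivity), mul_pow, sq (Real.exp _)]
    gcongr
    exact mul_le_of_le_one_left (Real.exp_pos _).le (Real.exp_le_one_iff.2 (by nlinarith))

/-- Boundedness of `F` suffices: the localizer supplies the decay that makes the product attain its
maximum modulus. -/
lemma IsBandlimited.tendsto_mul_comp_sub {S : Set (E d)} {F h : E d → ℂ} (hF : IsBandlimited S F)
    (hh : Filter.Tendsto h (Filter.cocompact (E d)) (nhds 0)) (η : E d) :
    Filter.Tendsto (fun ξ => F ξ * h (ξ - η)) (Filter.cocompact (E d)) (nhds 0) := by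
  obtain ⟨B, hB⟩ := hF.exists_norm_le
  have hlim := hh.comp (Homeomorph.subRight η).isClosedEmbedding.tendsto_cocompact
  refine squeeze_zero_norm (a := fun ξ => B * ‖h (ξ - η)‖) (fun ξ => ?_) ?_
  · rw [norm_mul]
    exact mul_le_mul_of_nonneg_right (hB ξ) (norm_nonneg _)
  · simpa using hlim.norm.const_mul B

/-! ### Comparison of sampled and continuous energies -/

/-- Sampled energies are bounded by local energies of the Fourier transform, up to an
exponentially small error. -/
theorem exists_tsum_fourier_le {D : Set (E d)} (hD : IsCenteredSymmetricConvexBody D) {r : ℝ}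
    (hr : 0 ≤ r) :
    ∃ c > 0, ∃ C : ℝ≥0∞, C ≠ ∞ ∧ ∀ (ι : Type) [Countable ι] (x : ι → E d) (W : ι → Set (E d)),
      (∀ i, MeasurableSet (W i)) → Pairwise (fun i j => volume (W i ∩ W j) = 0) →
      (∀ i, W i ⊆ Metric.closedBall (x i) r) →
      ∀ M : ℝ, 0 < M → ∀ T : Set (E d), MeasurableSet T → (∀ i, ∀ ξ ∉ T, M ≤ ‖ξ - x i‖) →
      ∀ f ∈ L2On D, ‖f‖ = 1 →
        ∑' i, volume (W i) * ‖𝓕 (f : E d → ℂ) (x i)‖ₑ ^ 2 ≤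
          C * (∫⁻ ξ in T, ‖𝓕 (f : E d → ℂ) ξ‖ₑ ^ 2) + C * ENNReal.ofReal (Real.exp (-c * M)) := by
  obtain ⟨R, hR, hDR⟩ := hD.exists_subset_closedBall
  obtain ⟨CA, hCA, HA⟩ := exists_enorm_sq_le_lintegral d (R := R + 1) (by linarith)
  obtain ⟨c, hc, C₁, hC₁, H₁⟩ := exists_localizer_enorm_sq d zero_lt_one
  obtain ⟨CU, hCU, HU⟩ := exists_tsum_decayProfile_le d hr
  refine ⟨c, hc, CA * (C₁ * CU), ENNReal.mul_ne_top hCA (ENNReal.mul_ne_top hC₁ hCU),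
    fun ι _ x W hW hdisj hsub M hM T hT hfar f hf hf1 => ?_⟩
  obtain ⟨h, hband, h0, hlim, hle, hlefar⟩ := H₁ M hM
  set φ : E d → ℂ := 𝓕 (f : E d → ℂ) with hφ
  have hφD : IsBandlimited D φ := isBandlimited_fourier hD.isCompact hD.zero_mem hf
  have hφm := hφD.continuous.measurable
  have hhm := hband.continuous.measurable
  set e := ENNReal.ofReal (Real.exp (-c * M)) with he
  -- The sup bound for `φ * h(· - x i)`, evaluated at `x i` where the localizer equals `1`.
  have hpoint : ∀ i, ‖φ (x i)‖ₑ ^ 2 ≤ CA * ∫⁻ ξ, ‖φ ξ‖ₑ ^ 2 * ‖h (ξ - x i)‖ₑ ^ 2 := by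
    intro i
    have := HA (fun ξ => φ ξ * h (ξ - x i))
      ((hφD.mono hDR).mul_closedBall (hband.comp_sub_const (x i)))
      (hφD.tendsto_mul_comp_sub hlim (x i)) (x i)
    simpa only [sub_self, h0, mul_one, enorm_mul, mul_pow] using this
  have hT1 : ∀ ξ, ∑' i, volume (W i) * ‖h (ξ - x i)‖ₑ ^ 2 ≤ C₁ * CU := by
    intro ξ
    calc _ ≤ ∑' i, C₁ * (volume (W i) * decayProfile (ξ - x i)) := by
          refine ENNReal.tsum_le_tsum fun i => ?_
          rw [mul_left_comm]
          exact mul_le_mul' le_rfl (hle _)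
      _ ≤ _ := by
          rw [ENNReal.tsum_mul_left]
          exact mul_le_mul' le_rfl (HU ι x W hW hdisj hsub ξ)
  have hT2 : ∀ ξ ∈ Tᶜ, ∑' i, volume (W i) * ‖h (ξ - x i)‖ₑ ^ 2 ≤ C₁ * CU * e := by
    intro ξ hξ
    calc _ ≤ ∑' i, C₁ * e * (volume (W i) * decayProfile (ξ - x i)) := by
          refine ENNReal.tsum_le_tsum fun i => ?_
          rw [mul_left_comm]
          exact mul_le_mul' le_rfl (hlefar _ (hfar i ξ hξ))
      _ ≤ C₁ * e * CU := by
          rw [ENNReal.tsum_mul_left]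
          exact mul_le_mul' le_rfl (HU ι x W hW hdisj hsub ξ)
      _ = _ := by ring
  have hplanch : ∫⁻ ξ, ‖φ ξ‖ₑ ^ 2 = 1 := by
    rw [hφ, lintegral_fourier_enorm_sq (integrable_of_mem_L2On hD.isCompact hf), ← ofReal_norm, hf1]
    simp
  calc ∑' i, volume (W i) * ‖φ (x i)‖ₑ ^ 2
      ≤ ∑' i, CA * ∫⁻ ξ, ‖φ ξ‖ₑ ^ 2 * (volume (W i) * ‖h (ξ - x i)‖ₑ ^ 2) := by
        refine ENNReal.tsum_le_tsum fun i => ?_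
        simp_rw [mul_left_comm (_ ^ 2) (volume (W i))]
        rw [lintegral_const_mul _ (by fun_prop), mul_left_comm CA]
        exact mul_le_mul' le_rfl (hpoint i)
    _ = CA * ∫⁻ ξ, ‖φ ξ‖ₑ ^ 2 * ∑' i, volume (W i) * ‖h (ξ - x i)‖ₑ ^ 2 := by
        rw [ENNReal.tsum_mul_left, ← lintegral_tsum fun i => by fun_prop]
        simp_rw [ENNReal.tsum_mul_left]
    _ = CA * ((∫⁻ ξ in T, ‖φ ξ‖ₑ ^ 2 * ∑' i, volume (W i) * ‖h (ξ - x i)‖ₑ ^ 2) +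
          ∫⁻ ξ in Tᶜ, ‖φ ξ‖ₑ ^ 2 * ∑' i, volume (W i) * ‖h (ξ - x i)‖ₑ ^ 2) := by
        rw [lintegral_add_compl _ hT]
    _ ≤ CA * ((∫⁻ ξ in T, ‖φ ξ‖ₑ ^ 2 * (C₁ * CU)) + ∫⁻ ξ in Tᶜ, ‖φ ξ‖ₑ ^ 2 * (C₁ * CU * e)) := by
        refine mul_le_mul' le_rfl (add_le_add (lintegral_mono fun ξ => ?_)
          (setLIntegral_mono' hT.compl fun ξ hξ => ?_))
        · exact mul_le_mul' le_rfl (hT1 ξ)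
        · exact mul_le_mul' le_rfl (hT2 ξ hξ)
    _ = CA * ((∫⁻ ξ in T, ‖φ ξ‖ₑ ^ 2) * (C₁ * CU) +
          (∫⁻ ξ in Tᶜ, ‖φ ξ‖ₑ ^ 2) * (C₁ * CU * e)) := by
        rw [lintegral_mul_const _ (by fun_prop), lintegral_mul_const _ (by fun_prop)]
    -- Off `T` the localizers give the small factor `e`, so the total energy, `1` by Plancherel, is
    -- enough.
    _ ≤ CA * ((∫⁻ ξ in T, ‖φ ξ‖ₑ ^ 2) * (C₁ * CU) + 1 * (C₁ * CU * e)) := by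
        gcongr
        rw [← hplanch]
        exact setLIntegral_le_lintegral _ _
    _ = _ := by ring

/-- Local energies of the Fourier transform are bounded by sampled energies, up to an
exponentially small error. -/
theorem exists_lintegral_fourier_le {D : Set (E d)} (hD : IsCenteredSymmetricConvexBody D) {ε : ℝ}
    (hε0 : 0 < ε) (hε1 : ε < 1) :
    ∃ c > 0, ∃ C : ℝ≥0∞, C ≠ ∞ ∧ ∀ Ω : Set (E d), IsClosed Ω → Ω.Countable →
      gap (polarSet D) Ω ≤ ENNReal.ofReal (1 / 4 * (1 - ε)) → ∀ S ⊆ Ω,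
      ∀ M : ℝ, 0 < M → ∀ T : Set (E d), MeasurableSet T →
      (∀ ω ∈ Ω \ S, ∀ ξ ∈ T, M ≤ ‖ω - ξ‖) →
      ∀ f ∈ L2On D, ‖f‖ = 1 →
        ∫⁻ ξ in T, ‖𝓕 (f : E d → ℂ) ξ‖ₑ ^ 2 ≤
          C * sampleEnergy (polarSet D) Ω S f + C * ENNReal.ofReal (Real.exp (-c * M)) := by
  have hb := hD.isCompact.isBounded
  obtain ⟨ρ, hρ, hDρ⟩ := hD.exists_closedBall_subset
  obtain ⟨r, hr, CB, hCB, HB⟩ := exists_enorm_sq_le_tsum hD hε0 hε1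
  obtain ⟨c, hc, C₁, hC₁, H₁⟩ := exists_localizer_enorm_sq d hr
  have hδ : 0 ≤ 1 / 4 * (1 - ε) := by linarith
  obtain ⟨c', hc', C', hC', H'⟩ := exists_tsum_fourier_le hD
    (r := 1 / 4 * (1 - ε) / ρ) (by positivity)
  set J := ∫⁻ x : E d, decayProfile x with hJ
  have hJt : J ≠ ∞ := lintegral_decayProfile_ne_top
  refine ⟨c, hc, CB * (C₁ * J) * (1 + (C' + C')), ENNReal.mul_ne_top (ENNReal.mul_ne_top hCB
    (ENNReal.mul_ne_top hC₁ hJt)) (by finiteness),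
    fun Ω hΩ hΩc hgap S hSΩ M hM T hT hfar f hf hf1 => ?_⟩
  obtain ⟨h, hband, h0, hlim, hle, hlefar⟩ := H₁ M hM
  have : Countable Ω := hΩc.to_subtype
  obtain ⟨W, hWm, hWV, hWd, hWc⟩ := exists_disjoint_measurable_subcover
    (V := fun ω : Ω => voronoiRegion (polarSet D) Ω ω)
    (fun ω => (isClosed_voronoiRegion hb _).measurableSet) fun z => by
      obtain ⟨ω, hω, hz⟩ := exists_mem_voronoiRegion hD hΩ (nonempty_of_gap_le hgap) z
      exact ⟨⟨ω, hω⟩, hz⟩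
  have hWg : ∀ i : Ω, ∀ z ∈ W i, gauge (polarSet D) (i - z) ≤ 1 / 4 * (1 - ε) :=
    fun i z hz => gauge_le_of_gap_le hgap hδ (hWV i hz)
  set φ : E d → ℂ := 𝓕 (f : E d → ℂ) with hφ
  have hφD : IsBandlimited D φ := isBandlimited_fourier hD.isCompact hD.zero_mem hf
  have hφm := hφD.continuous.measurable
  have hhm := hband.continuous.measurable
  set e := ENNReal.ofReal (Real.exp (-c * M)) with he
  have hplanch : ∫⁻ ξ, ‖φ ξ‖ₑ ^ 2 = 1 := by
    rw [hφ, lintegral_fourier_enorm_sq (integrable_of_mem_L2On hD.isCompact hf), ← ofReal_norm, hf1]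
    simp
  have htot : ∑' i : Ω, volume (W i) * ‖φ i‖ₑ ^ 2 ≤ C' + C' := by
    refine (H' Ω (fun i => i) W hWm (fun i j hij => by
      beta_reduce
      rw [(hWd hij).inter_eq, measure_empty]) (fun i z hz => ?_) 1 one_pos univ .univ
      (fun i ξ hξ => absurd (mem_univ ξ) hξ) f hf hf1).trans ?_
    · rw [mem_closedBall_iff_norm', le_div_iff₀' hρ]
      exact (norm_le_gauge_polarSet hb hρ hDρ _).trans (hWg i z hz)
    · rw [Measure.restrict_univ, ← hφ, hplanch, mul_one]
      gcongr
      refine mul_le_of_le_one_right' ?_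
      rw [ENNReal.ofReal_le_one, Real.exp_le_one_iff]
      linarith
  have hpoint : ∀ ξ, ‖φ ξ‖ₑ ^ 2 ≤
      CB * ∑' i : Ω, volume (W i) * ‖φ i‖ₑ ^ 2 * ‖h (i - ξ)‖ₑ ^ 2 := by
    intro ξ
    have := HB (fun η => φ η * h (η - ξ)) (hφD.mul (hband.comp_sub_const ξ))
      (hφD.tendsto_mul_comp_sub hlim ξ) Ω (fun i => i) W hWc hWg ξ
    simpa only [sub_self, h0, mul_one, enorm_mul, mul_pow, mul_assoc] using this
  have hJtrans : ∀ ω : E d, ∫⁻ ξ, decayProfile (ω - ξ) = J := fun ω => by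
    rw [hJ, lintegral_sub_left_eq_self (fun z => decayProfile z) ω]
  have hmeas : ∀ ω : E d, Measurable fun ξ => decayProfile (ω - ξ) := fun ω =>
    measurable_decayProfile.comp (by fun_prop)
  have hI1 : ∀ ω : E d, ∫⁻ ξ in T, ‖h (ω - ξ)‖ₑ ^ 2 ≤ C₁ * J := by
    intro ω
    calc _ ≤ ∫⁻ ξ, ‖h (ω - ξ)‖ₑ ^ 2 := setLIntegral_le_lintegral _ _
      _ ≤ ∫⁻ ξ, C₁ * decayProfile (ω - ξ) := lintegral_mono fun ξ => hle _
      _ = C₁ * J := by rw [lintegral_const_mul _ (hmeas ω), hJtrans]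
  have hI2 : ∀ ω ∈ Ω \ S, ∫⁻ ξ in T, ‖h (ω - ξ)‖ₑ ^ 2 ≤ C₁ * J * e := by
    intro ω hω
    calc _ ≤ ∫⁻ ξ in T, C₁ * e * decayProfile (ω - ξ) :=
          setLIntegral_mono' hT fun ξ hξ => hlefar _ (hfar ω hω ξ hξ)
      _ ≤ ∫⁻ ξ, C₁ * e * decayProfile (ω - ξ) := setLIntegral_le_lintegral _ _
      _ = C₁ * e * J := by rw [lintegral_const_mul _ (hmeas ω), hJtrans]
      _ = _ := by ring
  set a : E d → ℝ≥0∞ := fun ω => voronoiWeight (polarSet D) Ω ω * ‖φ ω‖ₑ ^ 2 with ha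
  have hsample : ∑' i : Ω, S.indicator a i = sampleEnergy (polarSet D) Ω S f := by
    rw [sampleEnergy, tsum_subtype Ω (S.indicator a), tsum_subtype S a, indicator_indicator,
      inter_eq_right.2 hSΩ]
  calc ∫⁻ ξ in T, ‖φ ξ‖ₑ ^ 2
      ≤ ∫⁻ ξ in T, CB * ∑' i : Ω, volume (W i) * ‖φ i‖ₑ ^ 2 * ‖h (i - ξ)‖ₑ ^ 2 :=
        lintegral_mono fun ξ => hpoint ξ
    _ = CB * ∑' i : Ω, volume (W i) * ‖φ i‖ₑ ^ 2 * ∫⁻ ξ in T, ‖h (i - ξ)‖ₑ ^ 2 := by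
        rw [lintegral_const_mul' _ _ hCB, lintegral_tsum fun i => by fun_prop]
        congr 2
        ext i
        rw [lintegral_const_mul _ (by fun_prop)]
    _ ≤ CB * ∑' i : Ω, (C₁ * J * S.indicator a i +
          C₁ * J * e * (volume (W i) * ‖φ i‖ₑ ^ 2)) := by
        refine mul_le_mul' le_rfl (ENNReal.tsum_le_tsum fun i => ?_)
        -- Samples in `S` enter with their full Voronoi weight; the others lie at distance at least
        -- `M` from `T` and keep only the weight of the disjoint subcell.
        by_cases hi : (i : E d) ∈ S
        · rw [indicator_of_mem hi, mul_comm]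
          exact le_add_right (mul_le_mul' (hI1 i) (mul_le_mul' (measure_mono (hWV i)) le_rfl))
        · rw [mul_comm]
          exact le_add_left (mul_le_mul' (hI2 i ⟨i.2, hi⟩) le_rfl)
    _ = CB * (C₁ * J * sampleEnergy (polarSet D) Ω S f +
          C₁ * J * e * ∑' i : Ω, volume (W i) * ‖φ i‖ₑ ^ 2) := by
        rw [ENNReal.tsum_add, ENNReal.tsum_mul_left, ENNReal.tsum_mul_left, hsample]
    _ ≤ CB * (C₁ * J * sampleEnergy (polarSet D) Ω S f + C₁ * J * e * (C' + C')) := by gcongr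
    _ = CB * (C₁ * J) * 1 * sampleEnergy (polarSet D) Ω S f +
          CB * (C₁ * J) * (C' + C') * e := by ring
    _ ≤ _ := by
        refine add_le_add ?_ ?_ <;> refine mul_le_mul' (mul_le_mul' le_rfl ?_) le_rfl
        · exact le_self_add
        · exact le_add_self

/-! ### From energy estimates to concentrations and residuals -/

/-- Since `M^α ≤ 1 + M`, one has `exp (-c M) ≤ exp c * exp (-c M^α)`. This is the only place where
`α` enters. -/
lemma exists_ofReal_exp_rpow_bound {α c : ℝ} (hα : α ∈ Ioo (0 : ℝ) 1) (hc : 0 < c) {C : ℝ≥0∞}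
    (hC : C ≠ ∞) :
    ∃ C' : ℝ, 0 < C' ∧ C ≤ ENNReal.ofReal C' ∧ ∀ M : ℝ, 0 < M →
      C * ENNReal.ofReal (Real.exp (-c * M)) ≤ ENNReal.ofReal (C' * Real.exp (-c * M ^ α)) := by
  have hexp : 1 ≤ Real.exp c := Real.one_le_exp hc.le
  have hCle : C ≤ ENNReal.ofReal ((C.toReal + 1) * Real.exp c) := by
    rw [← ENNReal.ofReal_toReal hC]
    refine ENNReal.ofReal_le_ofReal ?_
    rw [ENNReal.toReal_ofReal ENNReal.toReal_nonneg]
    nlinarith [ENNReal.toReal_nonneg (a := C)]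
  refine ⟨(C.toReal + 1) * Real.exp c, by positivity, hCle, fun M hM => ?_⟩
  have hMα : M ^ α ≤ 1 + M := by
    rcases le_total M 1 with h | h
    · exact (Real.rpow_le_one hM.le h hα.1.le).trans (by linarith)
    · exact (Real.rpow_le_rpow_of_exponent_le h hα.2.le).trans (by rw [Real.rpow_one]; linarith)
  calc C * ENNReal.ofReal (Real.exp (-c * M))
      ≤ ENNReal.ofReal (C.toReal + 1) * ENNReal.ofReal (Real.exp c * Real.exp (-c * M ^ α)) := by
        refine mul_le_mul' ?_ (ENNReal.ofReal_le_ofReal ?_)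
        · conv_lhs => rw [← ENNReal.ofReal_toReal hC]
          exact ENNReal.ofReal_le_ofReal (by linarith)
        · rw [← Real.exp_add]
          exact Real.exp_le_exp.2 (by nlinarith)
    _ = _ := by rw [← ENNReal.ofReal_mul (by positivity), mul_assoc]

/-- The sampled energy over part of a set of bounded gap is bounded by a local energy of the
Fourier transform, up to an exponentially small error. -/
theorem exists_sampleEnergy_le {d : ℕ} {D : Set (E d)} (hD : IsCenteredSymmetricConvexBody D)
    {L : ℝ} (hL : 0 < L) :
    ∃ c > 0, ∃ C : ℝ≥0∞, C ≠ ∞ ∧ ∀ Ω : Set (E d), Ω.Countable →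
      gap (Metric.closedBall 0 1) Ω ≤ ENNReal.ofReal L →
      Ω.Pairwise (fun ω ω' => volume
        (voronoiRegion (polarSet D) Ω ω ∩ voronoiRegion (polarSet D) Ω ω') = 0) →
      ∀ S ⊆ Ω, ∀ M : ℝ, 0 < M → ∀ T : Set (E d), MeasurableSet T →
      (∀ ω ∈ S, ∀ ξ ∉ T, M ≤ ‖ξ - ω‖) →
      ∀ f ∈ L2On D, ‖f‖ = 1 →
        sampleEnergy (polarSet D) Ω S f ≤
          C * (∫⁻ ξ in T, ‖𝓕 (f : E d → ℂ) ξ‖ₑ ^ 2) + C * ENNReal.ofReal (Real.exp (-c * M)) := by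
  have hb := hD.isCompact.isBounded
  obtain ⟨ρ, hρ, hDρ⟩ := hD.exists_closedBall_subset
  obtain ⟨R, hR, hDR⟩ := hD.exists_subset_closedBall
  obtain ⟨c, hc, C, hC, H⟩ := exists_tsum_fourier_le hD (r := R * (L + 1) / ρ) (by positivity)
  refine ⟨c, hc, C, hC, fun Ω hΩc hgap hdisj S hSΩ M hM T hT hfar f hf hf1 => ?_⟩
  have : Countable S := (hΩc.mono hSΩ).to_subtype
  refine H S (fun i => i) (fun i => voronoiRegion (polarSet D) Ω i)
    (fun i => (isClosed_voronoiRegion hb _).measurableSet)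
    (fun i j hij => hdisj (hSΩ i.2) (hSΩ j.2) (Subtype.coe_injective.ne hij)) (fun i z hz => ?_)
    M hM T hT (fun i ξ hξ => hfar i i.2 ξ hξ) f hf hf1
  -- The Euclidean gap gives a sample within `L + 1`, the extra `1` allowing for an unattained
  -- infimum; comparing the norms bounds each cell by radius `R (L + 1) / ρ`.
  obtain ⟨v, hv, hvz⟩ := exists_gauge_lt_of_gap_le hgap hL.le (lt_add_one L) z
  rw [gauge_closedBall zero_le_one, div_one] at hvz
  rw [mem_closedBall_iff_norm', le_div_iff₀' hρ]
  calc _ ≤ gauge (polarSet D) (i - z) := norm_le_gauge_polarSet hb hρ hDρ _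
    _ ≤ gauge (polarSet D) (v - z) := gauge_le_of_mem_voronoiRegion hz hv
    _ ≤ R * ‖v - z‖ := gauge_polarSet_le hR hDR _
    _ ≤ R * (L + 1) := by gcongr

/-- For empty `U` both infima are `∞`, and `C ≠ 0` prevents the product `0 * ∞ = 0`. -/
lemma biInf_le_mul_biInf_add {X : Type*} {U : Set X} {a b : X → ℝ≥0∞} {C e : ℝ≥0∞} (hC0 : C ≠ 0)
    (hC : C ≠ ∞) (h : ∀ f ∈ U, a f ≤ C * b f + e) :
    ⨅ f ∈ U, a f ≤ C * (⨅ f ∈ U, b f) + e := by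
  rw [iInf_subtype', iInf_subtype', ENNReal.mul_iInf_of_ne hC0 hC, ENNReal.iInf_add]
  exact iInf_mono fun f => h f f.2

lemma biSup_le_mul_biSup_add {X : Type*} {U : Set X} {a b : X → ℝ≥0∞} {C e : ℝ≥0∞}
    (h : ∀ f ∈ U, a f ≤ C * b f + e) :
    ⨆ f ∈ U, a f ≤ C * (⨆ f ∈ U, b f) + e :=
  iSup₂_le fun f hf => (h f hf).trans (by gcongr; exact le_iSup₂ (f := fun f _ => b f) f hf)

end FourierSampling

open FourierSampling
theorem theorem1p2 (d : ℕ) (D : Set (EuclideanSpace ℝ (Fin d)))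
    (hD : IsCenteredSymmetricConvexBody D) (α : ℝ) (hα : α ∈ Set.Ioo (0 : ℝ) 1) :
    -- upper bounds for the discrete quantities, constants depending only on `D`, `α`, `L`
    (∀ L : ℝ, 0 < L → ∃ c C : ℝ, 0 < c ∧ 0 < C ∧
      ∀ Ω : Set (EuclideanSpace ℝ (Fin d)), IsClosed Ω → Ω.Countable →
        gap (Metric.closedBall 0 1) Ω ≤ ENNReal.ofReal L →
        Ω.Pairwise (fun ω ω' => volume
          (voronoiRegion (polarSet D) Ω ω ∩ voronoiRegion (polarSet D) Ω ω') = 0) →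
      ∀ R : Submodule ℂ (Lp ℂ 2 (volume : Measure (EuclideanSpace ℝ (Fin d)))), R ≤ L2On D →
        (∀ K M : ℝ, 0 < K → 0 < M →
          discreteConcentration (polarSet D) R Ω K ≤
            ENNReal.ofReal C * continuousConcentration R (K + M)
              + ENNReal.ofReal (C * Real.exp (-c * M ^ α))) ∧
        (∀ K M : ℝ, 0 < M → M < K →
          discreteResidual (polarSet D) R Ω K ≤
            ENNReal.ofReal C * continuousResidual R (K - M)
              + ENNReal.ofReal (C * Real.exp (-c * M ^ α)))) ∧
    -- converse bounds, constants depending only on `D`, `α`, `ε`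
    (∀ ε : ℝ, 0 < ε → ∃ c C : ℝ, 0 < c ∧ 0 < C ∧
      ∀ Ω : Set (EuclideanSpace ℝ (Fin d)), IsClosed Ω → Ω.Countable →
        gap (polarSet D) Ω ≤ ENNReal.ofReal (1 / 4 * (1 - ε)) →
      ∀ R : Submodule ℂ (Lp ℂ 2 (volume : Measure (EuclideanSpace ℝ (Fin d)))), R ≤ L2On D →
        (∀ K M : ℝ, 0 < K → 0 < M →
          continuousConcentration R K ≤
            ENNReal.ofReal C * discreteConcentration (polarSet D) R Ω (K + M)
              + ENNReal.ofReal (C * Real.exp (-c * M ^ α))) ∧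
        (∀ K M : ℝ, 0 < K → 0 < M →
          continuousResidual R K ≤
            ENNReal.ofReal C * discreteResidual (polarSet D) R Ω (K - M)
              + ENNReal.ofReal (C * Real.exp (-c * M ^ α)))) := by
  have hmeas_le : ∀ K : ℝ, MeasurableSet {ξ : E d | ‖ξ‖ ≤ K} := fun K =>
    measurableSet_le measurable_norm measurable_const
  have hmeas_lt : ∀ K : ℝ, MeasurableSet {ξ : E d | K < ‖ξ‖} := fun K =>
    measurableSet_lt measurable_const measurable_norm
  have hnorm : ∀ x y : E d, ‖x‖ - ‖y‖ ≤ ‖x - y‖ := norm_sub_norm_le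
  refine ⟨fun L hL => ?_, fun ε hε => ?_⟩
  · obtain ⟨c, hc, C, hC, H⟩ := exists_sampleEnergy_le hD hL
    obtain ⟨C', hC', hCC', hexp⟩ := exists_ofReal_exp_rpow_bound hα hc hC
    refine ⟨c, C', hc, hC', fun Ω hΩ hΩc hgap hdisj R hR => ⟨fun K M hK hM => ?_,
      fun K M hM hMK => ?_⟩⟩
    · refine biInf_le_mul_biInf_add (by simpa using hC') ENNReal.ofReal_ne_top fun f hf => ?_
      refine (H Ω hΩc hgap hdisj _ inter_subset_left M hM _ (hmeas_le (K + M))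
        (fun ω hω ξ hξ => ?_) f (hR hf.1) hf.2).trans
        (add_le_add (mul_le_mul' hCC' le_rfl) (hexp M hM))
      have h1 := mem_closedBall_zero_iff.1 hω.2
      have h2 : K + M < ‖ξ‖ := not_le.1 hξ
      linarith [hnorm ξ ω]
    · refine biSup_le_mul_biSup_add fun f hf => ?_
      refine (H Ω hΩc hgap hdisj _ sdiff_subset M hM _ (hmeas_lt (K - M))
        (fun ω hω ξ hξ => ?_) f (hR hf.1) hf.2).trans
        (add_le_add (mul_le_mul' hCC' le_rfl) (hexp M hM))
      have h1 : K < ‖ω‖ := not_le.1 fun h => hω.2 (mem_closedBall_zero_iff.2 h)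
      have h2 : ‖ξ‖ ≤ K - M := not_lt.1 hξ
      rw [norm_sub_rev]
      linarith [hnorm ω ξ]
  -- The estimate needs `ε < 1`; decreasing `ε` only weakens the gap condition, so the minimum with
  -- `1/2` covers every `ε > 0`.
  · obtain ⟨c, hc, C, hC, H⟩ := exists_lintegral_fourier_le hD (ε := min ε (1 / 2))
      (lt_min hε (by norm_num)) ((min_le_right _ _).trans_lt (by norm_num))
    obtain ⟨C', hC', hCC', hexp⟩ := exists_ofReal_exp_rpow_bound hα hc hC
    refine ⟨c, C', hc, hC', fun Ω hΩ hΩc hgap R hR => ?_⟩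
    have hgap' : gap (polarSet D) Ω ≤ ENNReal.ofReal (1 / 4 * (1 - min ε (1 / 2))) :=
      hgap.trans (ENNReal.ofReal_le_ofReal (by linarith [min_le_left ε (1 / 2)]))
    refine ⟨fun K M hK hM => ?_, fun K M hK hM => ?_⟩
    · refine biInf_le_mul_biInf_add (by simpa using hC') ENNReal.ofReal_ne_top fun f hf => ?_
      refine (H Ω hΩ hΩc hgap' _ inter_subset_left M hM _ (hmeas_le K)
        (fun ω hω ξ hξ => ?_) f (hR hf.1) hf.2).trans
        (add_le_add (mul_le_mul' hCC' le_rfl) (hexp M hM))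
      have h1 : K + M < ‖ω‖ := not_le.1 fun h => hω.2 ⟨hω.1, mem_closedBall_zero_iff.2 h⟩
      have h2 : ‖ξ‖ ≤ K := hξ
      linarith [hnorm ω ξ]
    · refine biSup_le_mul_biSup_add fun f hf => ?_
      refine (H Ω hΩ hΩc hgap' _ sdiff_subset M hM _ (hmeas_lt K)
        (fun ω hω ξ hξ => ?_) f (hR hf.1) hf.2).trans
        (add_le_add (mul_le_mul' hCC' le_rfl) (hexp M hM))
      -- For `K < M` the removed ball is empty, no sample is left out, and the condition on `ω` is
      -- vacuous.
      have h1 : ‖ω‖ ≤ K - M := by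
        by_contra h
        exact hω.2 ⟨hω.1, fun h' => h (mem_closedBall_zero_iff.1 h')⟩
      have h2 : K < ‖ξ‖ := hξ
      rw [norm_sub_rev]
      linarith [hnorm ξ ω]
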